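/- Let $q\ge 2$ and let $T=\mathbb T_q$ be the regular tree of degree $q+1$, with graph distance $d$, a root $o$, and boundary $\partial T$ (the set of ends, each represented by a unique geodesic ray starting at $o$). For $x\in T$ let $\partial T_x$ be the boundary arc of all ends whose ray from $o$ passes through $x$; the arcs generate the topology of $\partial T$. For $x\in T$ and $\xi\in\partial T$ let $x\wedge\xi$ be the last common vertex of the geodesics from $o$ to $x$ and from $o$ to $\xi$. Fix a reference end $\varpi$, put $\mathfrak h(x)=d(x,x\wedge\varpi)-d(o,x\wedge\varpi)$, and for $0<\alpha<1$ consider the random walk with $p(x,y)=\alpha/q$ if $x\sim y$ and $\mathfrak h(y)=\mathfrak h(x)+1$, and $p(x,y)=1-\alpha$ if $x\sim y$ and $\mathfrak h(y)=\mathfrak h(x)-1$. Write $Ph(x)=\sum_{y\sim x}p(x,y)h(y)$, $\rho=2\sqrt{\alpha(1-\alpha)}$ (the spectral radius of $P$) and $\lambda_0=\frac{q+1}{2\sqrt q}\,\rho$. For $\lambda\in\mathbb C\setminus[-\rho,\rho]$ put, with the principal branch of the square root, $$F_-(\lambda)=\tfrac{\lambda}{2\alpha}\Bigl(1-\sqrt{1-4\alpha(1-\alpha)/\lambda^2}\Bigr),\qquad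 \widetilde F_-(\lambda)=\tfrac{\lambda}{2\alpha}\Bigl(1+\sqrt{1-4\alpha(1-\alpha)/\lambda^2}\Bigr),$$ $$F_+(\lambda)=\tfrac{\alpha}{(1-\alpha)q}F_-(\lambda),\qquad \widetilde F_+(\lambda)=\tfrac{\alpha}{(1-\alpha)q}\widetilde F_-(\lambda).$$ For vertices $x,y$ let $F(x,y|\lambda)$ be the product, over the oriented edges $(u,v)$ of the geodesic from $x$ to $y$, of the weights $F_\pm(\lambda)$ according to $\mathfrak h(v)=\mathfrak h(u)\pm1$, and put $K(x,\xi|\lambda)=F(x,x\wedge\xi|\lambda)/F(o,x\wedge\xi|\lambda)$ (the $\lambda$-Martin kernel); define $\widetilde F(x,y|\lambda)$ and $\widetilde K(x,\xi|\lambda)$ in the same way from $\widetilde F_\pm(\lambda)$. A distribution on $\partial T$ is a complex-valued set function $\nu$ on the boundary arcs such that $\nu(\partial T_x)=\sum_{y}\nu(\partial T_y)$ for every $x\in T$, where $y$ ranges over the neighbours of $x$ with $d(o,y)=d(o,x)+1$. If $\varphi:\partial T\to\mathbb C$ has the constant value $c_x$ on $\partial T_x$ for every $x$ with $d(o,x)=n$,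 then $\int_{\partial T}\varphi\,d\nu=\sum_{d(o,x)=n}c_x\,\nu(\partial T_x)$. **Theorem.** Let $\lambda\in\mathbb C\setminus[-\rho,\rho]$ with $\lambda\ne\lambda_0$, and let $\xi\in\partial T$. 1. There is a unique distribution $\nu^\xi$ on $\partial T$ with $\widetilde K(x,\xi|\lambda)=\int_{\partial T}K(x,\cdot|\lambda)\,d\nu^\xi$ for all $x\in T$, and $\nu^\xi$ extends to a $\sigma$-additive complex Borel measure on $\partial T$. 2. If in addition $\lambda\ne-\lambda_0$, there is a unique distribution $\tilde\nu^\xi$ on $\partial T$ with $K(x,\xi|\lambda)=\int_{\partial T}\widetilde K(x,\cdot|\lambda)\,d\tilde\nu^\xi$ for all $x\in T$, and $\tilde\nu^\xi$ does not extend to a $\sigma$-additive complex Borel measure on $\partial T$. 3. If $\lambda>\rho$ is real, then $\nu^\xi$ extends to a Borel probability measure whose support is all of $\partial T$, and $\widetilde K(\cdot,\xi|\lambda)$ belongs to the convex set $\mathcal H_o(\lambda)=\{h:T\to(0,\infty)\mid h(o)=1,\ Ph=\lambda h\}$ but is not minimal, that is, it is not an extreme point of $\mathcal H_o(\lambda)$.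 -/

import Mathlib

open MeasureTheory

/-- An end of the tree `G`, given by the unique geodesic ray `[o = x₀, x₁, x₂, …]` (consecutive
vertices adjacent, no backtracking) which starts at the root `o` and represents the end. -/
@[ext]
structure TreeEnd {V : Type*} (G : SimpleGraph V) (o : V) where
  /-- the vertices of the ray -/
  vertex : ℕ → V
  vertex_zero : vertex 0 = o
  adj : ∀ n, G.Adj (vertex n) (vertex (n + 1))
  no_backtrack : ∀ n, vertex (n + 2) ≠ vertex n

namespace TreeEnd

variable {V : Type*} {G : SimpleGraph V} {o : V}

/-- The boundary arc `∂T_x`: the ends whose geodesic ray from the root passes through `x`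
(and hence stays in the branch `T_x` from then on). -/
def arc (G : SimpleGraph V) (o x : V) : Set (TreeEnd G o) := {ξ | ∃ n, ξ.vertex n = x}

/-- The topology of the boundary `∂T`: it is generated by the boundary arcs. -/
instance : TopologicalSpace (TreeEnd G o) :=
  TopologicalSpace.generateFrom (Set.range (arc G o))

/-- The Borel σ-algebra of `∂T`. -/
instance : MeasurableSpace (TreeEnd G o) := borel _

instance : BorelSpace (TreeEnd G o) := ⟨rfl⟩

/-- The confluent `x ∧ ξ` with respect to `o`: the last vertex of the ray of `ξ` which lies on the
geodesic from `o` to `x`. -/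
noncomputable def confluent (x : V) (ξ : TreeEnd G o) : V :=
  ξ.vertex (Nat.findGreatest
    (fun n => G.dist o (ξ.vertex n) + G.dist (ξ.vertex n) x = G.dist o x) (G.dist o x))

/-- The horocycle index `𝔥(x, ξ) = d(x, x ∧ ξ) - d(o, x ∧ ξ)`. -/
noncomputable def hor (x : V) (ξ : TreeEnd G o) : ℤ :=
  (G.dist x (confluent x ξ) : ℤ) - (G.dist o (confluent x ξ) : ℤ)

end TreeEnd

section Weights

variable {V : Type*} {G : SimpleGraph V} {o : V}

/-- The geodesic path `π(x, y)` of a tree. -/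
noncomputable def geodesic (hG : G.IsTree) (x y : V) : G.Walk x y :=
  (hG.existsUnique_path x y).choose

/-- The extension of edge weights `f` to all pairs of vertices: `f(x, y)` is the product of
the weights of the oriented edges of the geodesic from `x` to `y` (so `f(x, x) = 1`). -/
noncomputable def pathWeight (hG : G.IsTree) (f : V → V → ℂ) (x y : V) : ℂ :=
  ((geodesic hG x y).darts.map fun d => f d.fst d.snd).prod

/-- The Poisson kernel `k(x, ξ) = f(x, x ∧ ξ) / f(o, x ∧ ξ)` of the edge weights `f`. -/
noncomputable def treePoissonKernel (hG : G.IsTree) (f : V → V → ℂ) (x : V) (ξ : TreeEnd G o) : ℂ :=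
  pathWeight hG f x (ξ.confluent x) / pathWeight hG f o (ξ.confluent x)

/-- The edge weights which are invariant under the affine group fixing the end `ϖ`: for
neighbours `x`, `y` the weight is `a` if `𝔥(y) = 𝔥(x) + 1` and `b` if `𝔥(y) = 𝔥(x) - 1`. -/
noncomputable def affineWeight {R : Type*} [Zero R] (ϖ : TreeEnd G o) (a b : R) (x y : V) : R :=
  if ϖ.hor y = ϖ.hor x + 1 then a else if ϖ.hor y = ϖ.hor x - 1 then b else 0

end Weights

/-- The spectral radius `ρ = 2 √(α (1 - α))`. -/
noncomputable def rho (α : ℝ) : ℝ := 2 * √(α * (1 - α))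

/-- The exceptional value `λ₀ = (q + 1) / (2 √q) · ρ`. -/
noncomputable def lambda0 (q : ℕ) (α : ℝ) : ℝ := ((q : ℝ) + 1) / (2 * √(q : ℝ)) * rho α

/-- `√(1 - 4 α (1 - α) / λ²)`, with the principal branch of the square root. -/
noncomputable def sqrtTerm (α : ℝ) (lam : ℂ) : ℂ :=
  Complex.sqrt (1 - 4 * (α : ℂ) * (1 - (α : ℂ)) / lam ^ 2)

/-- `F₋(λ)`, the solution of `λ F = (1 - α) + α F²` which belongs to the Green function. -/
noncomputable def Fminus (α : ℝ) (lam : ℂ) : ℂ := lam / (2 * (α : ℂ)) * (1 - sqrtTerm α lam)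

/-- `F̃₋(λ)`, the other solution of `λ F = (1 - α) + α F²`. -/
noncomputable def FminusTwin (α : ℝ) (lam : ℂ) : ℂ :=
  lam / (2 * (α : ℂ)) * (1 + sqrtTerm α lam)

/-- `F₊(λ) = α / ((1 - α) q) · F₋(λ)`. -/
noncomputable def Fplus (q : ℕ) (α : ℝ) (lam : ℂ) : ℂ :=
  (α : ℂ) / ((1 - (α : ℂ)) * (q : ℂ)) * Fminus α lam

/-- `F̃₊(λ) = α / ((1 - α) q) · F̃₋(λ)`. -/
noncomputable def FplusTwin (q : ℕ) (α : ℝ) (lam : ℂ) : ℂ :=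
  (α : ℂ) / ((1 - (α : ℂ)) * (q : ℂ)) * FminusTwin α lam

section Boundary

variable {V : Type*} {G : SimpleGraph V} {o : V}

/-- The `λ`-Martin kernel `K(x, ξ | λ)`. -/
noncomputable def martinKernel (hG : G.IsTree) (ϖ : TreeEnd G o) (q : ℕ) (α : ℝ) (lam : ℂ)
    (x : V) (ξ : TreeEnd G o) : ℂ :=
  treePoissonKernel hG (affineWeight ϖ (Fplus q α lam) (Fminus α lam)) x ξ

/-- The twin kernel `K̃(x, ξ | λ)`. -/
noncomputable def twinKernel (hG : G.IsTree) (ϖ : TreeEnd G o) (q : ℕ) (α : ℝ) (lam : ℂ)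
    (x : V) (ξ : TreeEnd G o) : ℂ :=
  treePoissonKernel hG (affineWeight ϖ (FplusTwin q α lam) (FminusTwin α lam)) x ξ

/-- Distributions on the boundary of a locally finite tree, as set functions on the boundary arcs:
`ν x` stands for `ν(∂T_x)`, and `ν(∂T_x) = ∑ ν(∂T_y)` over the forward neighbours `y` of `x`.
(All sums are finite, so every distribution is strong.) -/
def IsDistribution (G : SimpleGraph V) [G.LocallyFinite] (o : V) (ν : V → ℂ) : Prop :=
  ∀ x, ν x = ∑ y ∈ (G.neighborFinset x).filter (fun y => G.dist o y = G.dist o x + 1), ν y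

/-- `φ` is locally constant and `∫ φ dν = I`: for some level `n`, the function `φ` has
a constant value `c x` on each arc `∂T_x` with `|x| = n`, and the integral is the (finite) sum
of the `c x · ν(∂T_x)`. -/
def HasDistIntegral (ν : V → ℂ) (φ : TreeEnd G o → ℂ) (I : ℂ) : Prop :=
  ∃ (n : ℕ) (c : V → ℂ), (∀ x, G.dist o x = n → ∀ ξ ∈ TreeEnd.arc G o x, φ ξ = c x) ∧
    I = ∑ᶠ x ∈ {x : V | G.dist o x = n}, c x * ν x

/-- `ν` is a distribution which represents the function `h` through the kernel `k`:
`h(x) = ∫ k(x, ·) dν` for all `x`. -/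
def Represents (G : SimpleGraph V) [G.LocallyFinite] (o : V) (k : V → TreeEnd G o → ℂ)
    (ν : V → ℂ) (h : V → ℂ) : Prop :=
  IsDistribution G o ν ∧ ∀ x, HasDistIntegral ν (k x) (h x)

/-- The distribution `ν` extends to a σ-additive complex Borel measure on `∂T`. -/
def ExtendsToMeasure (G : SimpleGraph V) (o : V) (ν : V → ℂ) : Prop :=
  ∃ μ : ComplexMeasure (TreeEnd G o), ∀ x, μ (TreeEnd.arc G o x) = ν x

/-- The transition probabilities: for neighbours `x ∼ y`, `p(x, y) = α / q` if
`𝔥(y) = 𝔥(x) + 1` and `p(x, y) = 1 - α` if `𝔥(y) = 𝔥(x) - 1`; and `(P h)(x) = ∑ p(x, y) h(y)`. -/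
noncomputable def transOp [G.LocallyFinite] (ϖ : TreeEnd G o) (q : ℕ) (α : ℝ)
    (h : V → ℝ) (x : V) : ℝ :=
  ∑ y ∈ G.neighborFinset x, affineWeight ϖ (α / (q : ℝ)) (1 - α) x y * h y

/-- The convex set of the positive `λ`-harmonic functions with value `1` at the root. -/
def positiveHarmonic [G.LocallyFinite] (ϖ : TreeEnd G o) (q : ℕ) (α l : ℝ) : Set (V → ℝ) :=
  {h | (∀ x, 0 < h x) ∧ h o = 1 ∧ ∀ x, transOp ϖ q α h x = l * h x}

end Boundary

/-!
The two families of edge weights enter only through `F₋`, `F̃₋`, which satisfy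
`F₋ F̃₋ = (1 - α) / α` and, since the real part of the square root is positive off `[-ρ, ρ]`,
`|F₋| < |F̃₋|`. Put `u = 1 / (F₊ F₋) = q F̃₋ / F₋`, so `|u| > q`. Going back and forth along an edge
multiplies a path weight by `F₊ F₋`; hence `K(x, η) = g(x) u ^ |x ∧ η|` with `g(x) = F(x, o)`
(`treePoissonKernel_affine`), and `K̃(x, ξ) = g(x) H(x)` with
`H(x) = (u / q) ^ |x| (q² / u) ^ |x ∧ ξ|` (`twinRatio`, `treePoissonKernel_affine_twin`).
Exchanging the two kernels means replacing `u` by `q² / u`, which has modulus less than `q`.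

When `x` is replaced by a child `y`, the integral of `u ^ |x ∧ η|` against a distribution `ν`
changes by `(u ^ |y| - u ^ |x|) ν(∂T_y)`. So `H` determines `ν` as soon as `u ≠ 0, 1`, and the
set function obtained in this way is additive exactly when
`∑ H(children of x) + u H(parent of x) = (q + u) H(x)`, which is the harmonicity of `g H` and holds
for `twinRatio` (`represents_iff_eq_distOf`, `isReducedHarmonic_twinRatio`). The excluded values
`± λ₀` are those where `q² / u = 1`.

With respect to the uniform measure on `∂T`, which is the law of a ray choosing its steps uniformly
and independently, `ν` has density proportional to `(q² / u) ^ k` on the ends which leave the ray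
of `ξ` at level `k`. For `|u| > q` this density is integrable, and positive if `u` is real
(`extendsToMeasure_distOf`, `exists_probability_measure_distOf`). For `|u| < q` the masses
`(q / u) ^ n (q - 1) / (u - 1)` of the arcs shrinking to `ξ` are unbounded, which no complex measure
allows (`not_extendsToMeasure_distOf`).

Finally, for real `λ > ρ` take two neighbours of the root off the ray of `ξ`. The function
`(u / q) ^ |x| - 1` on one of their branches and its negative on the other one solves the same
equation as `H` and is smaller than `H` in modulus, so `g H` is the midpoint of two different
positive harmonic functions (`mul_twinRatio_not_extreme`).
-/

/-! ### The rooted tree: children, levels and confluents -/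

section Tree

variable {V : Type*} {G : SimpleGraph V} {o : V}

/-- `y` is a child (forward neighbour) of `x` in the tree rooted at `o`. -/
def IsChild (G : SimpleGraph V) (o x y : V) : Prop := G.Adj x y ∧ G.dist o y = G.dist o x + 1

theorem exists_adj_dist_eq (hG : G.Connected) {a x : V} (h : a ≠ x) :
    ∃ z, G.Adj z x ∧ G.dist a x = G.dist a z + 1 := by
  obtain ⟨p, hp⟩ := hG.exists_walk_length_eq_dist a x
  have hn : ¬ p.Nil := SimpleGraph.Walk.not_nil_of_ne h
  have hadj := p.adj_penultimate hn
  refine ⟨p.penultimate, hadj, ?_⟩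
  have h1 := SimpleGraph.dist_le p.dropLast
  have h2 := SimpleGraph.Walk.length_dropLast_add_one hn
  have h3 : G.dist a x ≤ G.dist a p.penultimate + G.dist p.penultimate x := hG.dist_triangle
  rw [SimpleGraph.dist_eq_one_iff_adj.2 hadj] at h3
  omega

theorem exists_parent (hG : G.IsTree) {x : V} (h : x ≠ o) : ∃ z, IsChild G o z x := by
  obtain ⟨z, hz, hd⟩ := exists_adj_dist_eq hG.connected h.symm
  exact ⟨z, hz, hd⟩

theorem IsChild.parent_unique (hG : G.IsTree) {x x' y : V} (h : IsChild G o x y)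
    (h' : IsChild G o x' y) : x = x' := by
  obtain ⟨p, hp⟩ := hG.connected.exists_walk_length_eq_dist o x
  obtain ⟨p', hp'⟩ := hG.connected.exists_walk_length_eq_dist o x'
  have hc : (p.concat h.1).IsPath := (p.concat h.1).isPath_of_length_eq_dist (by
    rw [SimpleGraph.Walk.length_concat, hp, h.2])
  have hc' : (p'.concat h'.1).IsPath := (p'.concat h'.1).isPath_of_length_eq_dist (by
    rw [SimpleGraph.Walk.length_concat, hp', h'.2])
  have := congrArg SimpleGraph.Walk.penultimate
    ((hG.existsUnique_path o y).unique hc hc')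
  simpa using this

theorem adj_iff_isChild (hG : G.IsTree) {x y : V} :
    G.Adj x y ↔ IsChild G o x y ∨ IsChild G o y x := by
  constructor
  · intro h
    rcases hG.dist_eq_dist_add_one_of_adj o h with h' | h'
    · exact Or.inr ⟨h.symm, h'⟩
    · exact Or.inl ⟨h, h'⟩
  · rintro (h | h)
    exacts [h.1, h.1.symm]

/-- Induction along the tree, from the root to the children. -/
theorem tree_induction (hG : G.IsTree) {P : V → Prop} (root : P o)
    (child : ∀ x y, IsChild G o x y → P x → P y) (x : V) : P x := by
  induction hn : G.dist o x generalizing x with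
  | zero => rwa [← hG.connected.dist_eq_zero_iff.1 hn]
  | succ n ih =>
    have hne : x ≠ o := by rintro rfl; simp at hn
    obtain ⟨z, hz⟩ := exists_parent hG hne
    exact child z x hz (ih z (by have := hz.2; omega))

/-- The vertices `a` and `y ≠ a` are in line with the root exactly when `a` and the parent of `y`
are. -/
theorem IsChild.dist_add_dist_iff (hG : G.IsTree) {x y a : V} (h : IsChild G o x y)
    (ha : a ≠ y) : G.dist o a + G.dist a y = G.dist o y ↔
      G.dist o a + G.dist a x = G.dist o x := by
  have hc := hG.connected
  have hxy := SimpleGraph.dist_eq_one_iff_adj.2 h.1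
  have t1 : G.dist a y ≤ G.dist a x + G.dist x y := hc.dist_triangle
  have t2 : G.dist o y ≤ G.dist o a + G.dist a y := hc.dist_triangle
  have hd := h.2
  constructor
  · intro h'
    obtain ⟨z, hz, hzd⟩ := exists_adj_dist_eq hc ha
    have t3 : G.dist o z ≤ G.dist o a + G.dist a z := hc.dist_triangle
    have hz' : IsChild G o z y := by
      rcases hG.dist_eq_dist_add_one_of_adj o hz with h1 | h1
      · omega
      · exact ⟨hz, h1⟩
    rw [h.parent_unique hG hz'] at hd ⊢
    omega
  · intro h'
    omega

namespace TreeEnd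

theorem isChild_vertex (hG : G.IsTree) (ξ : TreeEnd G o) (n : ℕ) :
    IsChild G o (ξ.vertex n) (ξ.vertex (n + 1)) := by
  induction n with
  | zero =>
    have h := ξ.adj 0
    refine ⟨h, ?_⟩
    have h1 := SimpleGraph.dist_eq_one_iff_adj.2 h
    rw [ξ.vertex_zero] at h1 ⊢
    simp only [zero_add] at h1 ⊢
    simp [h1]
  | succ n ih =>
    rcases (adj_iff_isChild (o := o) hG).1 (ξ.adj (n + 1)) with h | h
    · exact h
    · exact absurd (h.parent_unique hG ih) (ξ.no_backtrack n)

@[simp] theorem dist_vertex (hG : G.IsTree) (ξ : TreeEnd G o) (n : ℕ) :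
    G.dist o (ξ.vertex n) = n := by
  induction n with
  | zero => simp [ξ.vertex_zero]
  | succ n ih => rw [(ξ.isChild_vertex hG n).2, ih]

theorem mem_arc (hG : G.IsTree) {ξ : TreeEnd G o} {x : V} :
    ξ ∈ arc G o x ↔ ξ.vertex (G.dist o x) = x := by
  constructor
  · rintro ⟨n, rfl⟩
    rw [dist_vertex hG]
  · exact fun h => ⟨_, h⟩

theorem arc_root : arc G o o = Set.univ := by
  ext ξ
  simp only [Set.mem_univ, iff_true]
  exact ⟨0, ξ.vertex_zero⟩

theorem vertex_of_isChild (hG : G.IsTree) {ξ : TreeEnd G o} {x y : V} (h : IsChild G o x y)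
    (hy : ξ.vertex (G.dist o y) = y) : ξ.vertex (G.dist o x) = x := by
  rw [h.2] at hy
  have := ξ.isChild_vertex hG (G.dist o x)
  rw [hy] at this
  exact this.parent_unique hG h

theorem arc_child_subset (hG : G.IsTree) {x y : V} (h : IsChild G o x y) :
    arc G o y ⊆ arc G o x := fun ξ hξ => by
  rw [mem_arc hG] at hξ ⊢
  exact vertex_of_isChild hG h hξ

/-- Two rays through the same vertex agree up to that vertex. -/
theorem vertex_eq_of_le (hG : G.IsTree) {ξ η : TreeEnd G o} {n m : ℕ}
    (h : ξ.vertex n = η.vertex n) (hm : m ≤ n) : ξ.vertex m = η.vertex m := by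
  induction n with
  | zero => obtain rfl : m = 0 := by omega
            exact h
  | succ n ih =>
    rcases Nat.lt_or_ge n m with h' | h'
    · obtain rfl : m = n + 1 := by omega
      exact h
    · refine ih ?_ h'
      have h1 := ξ.isChild_vertex hG n
      rw [h] at h1
      exact h1.parent_unique hG (η.isChild_vertex hG n)

/-- The level `|x ∧ ξ|` of the confluent. -/
noncomputable def confLevel (x : V) (ξ : TreeEnd G o) : ℕ :=
  Nat.findGreatest
    (fun n => G.dist o (ξ.vertex n) + G.dist (ξ.vertex n) x = G.dist o x) (G.dist o x)

theorem confluent_eq (x : V) (ξ : TreeEnd G o) : confluent x ξ = ξ.vertex (confLevel x ξ) := rfl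

theorem confLevel_le (x : V) (ξ : TreeEnd G o) : confLevel x ξ ≤ G.dist o x :=
  Nat.findGreatest_le _

theorem confLevel_spec (hG : G.IsTree) (x : V) (ξ : TreeEnd G o) :
    confLevel x ξ + G.dist (confluent x ξ) x = G.dist o x := by
  have := Nat.findGreatest_spec (P := fun n => G.dist o (ξ.vertex n) + G.dist (ξ.vertex n) x
    = G.dist o x) (n := G.dist o x) (m := 0) (Nat.zero_le _) (by simp [ξ.vertex_zero])
  change G.dist o (ξ.vertex (confLevel x ξ)) + G.dist (ξ.vertex (confLevel x ξ)) x = _ at this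
  rwa [dist_vertex hG] at this

@[simp] theorem confLevel_root (ξ : TreeEnd G o) : confLevel o ξ = 0 := by
  have := confLevel_le o ξ
  simpa using this

theorem confLevel_of_vertex_eq {x : V} {ξ : TreeEnd G o}
    (h : ξ.vertex (G.dist o x) = x) : confLevel x ξ = G.dist o x := by
  refine le_antisymm (confLevel_le _ _) (Nat.le_findGreatest le_rfl ?_)
  rw [h]; simp

/-- Passing from a vertex to a child off the ray of `ξ` does not change the confluent. -/
theorem confLevel_child (hG : G.IsTree) {x y : V} {ξ : TreeEnd G o} (h : IsChild G o x y)
    (hy : ξ.vertex (G.dist o y) ≠ y) : confLevel y ξ = confLevel x ξ := by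
  have hne : ∀ n, ξ.vertex n ≠ y := fun n hn => hy (by rw [← hn, dist_vertex hG])
  unfold confLevel
  simp_rw [h.dist_add_dist_iff hG (hne _)]
  rw [h.2, Nat.findGreatest_succ, if_neg]
  rw [dist_vertex hG]
  omega

theorem hor_eq (hG : G.IsTree) (x : V) (ξ : TreeEnd G o) :
    hor x ξ = (G.dist o x : ℤ) - 2 * confLevel x ξ := by
  have := confLevel_spec hG x ξ
  rw [hor, SimpleGraph.dist_comm, ← this, confluent_eq, dist_vertex hG]
  push_cast
  ring

theorem hor_child (hG : G.IsTree) {x y : V} (ϖ : TreeEnd G o) (h : IsChild G o x y) :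
    ϖ.hor y = ϖ.hor x + 1 ∨ ϖ.hor y = ϖ.hor x - 1 := by
  rw [hor_eq hG, hor_eq hG]
  by_cases hy : ϖ.vertex (G.dist o y) = y
  · right
    rw [confLevel_of_vertex_eq hy, confLevel_of_vertex_eq (vertex_of_isChild hG h hy), h.2]
    push_cast; ring
  · left
    rw [confLevel_child hG h hy, h.2]
    push_cast; ring

end TreeEnd

/-! ### Path weights and Poisson kernels -/

theorem geodesic_eq (hG : G.IsTree) {x y : V} {p : G.Walk x y} (hp : p.IsPath) :
    geodesic hG x y = p :=
  (hG.existsUnique_path x y).unique (hG.existsUnique_path x y).choose_spec.1 hp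

theorem length_geodesic (hG : G.IsTree) (x y : V) : (geodesic hG x y).length = G.dist x y := by
  obtain ⟨p, hp, hl⟩ := hG.connected.exists_path_of_dist x y
  rw [geodesic_eq hG hp, hl]

theorem pathWeight_self (hG : G.IsTree) (f : V → V → ℂ) (x : V) : pathWeight hG f x x = 1 := by
  rw [pathWeight, geodesic_eq hG SimpleGraph.Walk.IsPath.nil]
  simp

theorem pathWeight_cons (hG : G.IsTree) (f : V → V → ℂ) {y x a : V} (h : G.Adj y x)
    (hd : G.dist y a = G.dist x a + 1) :
    pathWeight hG f y a = f y x * pathWeight hG f x a := by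
  rw [pathWeight, pathWeight, geodesic_eq hG (p := .cons h (geodesic hG x a))]
  · simp
  · apply SimpleGraph.Walk.isPath_of_length_eq_dist
    rw [SimpleGraph.Walk.length_cons, length_geodesic, hd]

theorem pathWeight_concat (hG : G.IsTree) (f : V → V → ℂ) {y x a : V} (h : G.Adj x y)
    (hd : G.dist a y = G.dist a x + 1) :
    pathWeight hG f a y = pathWeight hG f a x * f x y := by
  rw [pathWeight, pathWeight, geodesic_eq hG (p := (geodesic hG a x).concat h)]
  · simp [SimpleGraph.Walk.darts_concat]
  · apply SimpleGraph.Walk.isPath_of_length_eq_dist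
    rw [SimpleGraph.Walk.length_concat, length_geodesic, hd]

/-- Edge weights whose two orientations always multiply to `w` have Poisson kernel
`f(x, o) w ^ (-|x ∧ ξ|)`: going back and forth along `π(x ∧ ξ, o)` contributes one `w` per edge. -/
theorem treePoissonKernel_eq (hG : G.IsTree) (f : V → V → ℂ) {w : ℂ} (hw : w ≠ 0)
    (hf : ∀ x y, IsChild G o x y → f x y * f y x = w) (x : V) (ξ : TreeEnd G o) :
    treePoissonKernel hG f x ξ = pathWeight hG f x o * w⁻¹ ^ ξ.confLevel x := by
  induction x using tree_induction (o := o) hG with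
  | root =>
    rw [treePoissonKernel, TreeEnd.confluent_eq, TreeEnd.confLevel_root, ξ.vertex_zero]
    simp [pathWeight_self]
  | child x y h ih =>
    have hcons : pathWeight hG f y o = f y x * pathWeight hG f x o :=
      pathWeight_cons hG f h.1.symm (by rw [G.dist_comm, h.2, G.dist_comm])
    have hfne : f x y ≠ 0 := left_ne_zero_of_mul (by rw [hf x y h]; exact hw)
    have hfw : f y x = w / f x y := by rw [← hf x y h]; field_simp
    rw [treePoissonKernel] at ih ⊢
    by_cases hy : ξ.vertex (G.dist o y) = y
    · have hx := TreeEnd.vertex_of_isChild hG h hy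
      rw [TreeEnd.confluent_eq, TreeEnd.confLevel_of_vertex_eq hx, hx, pathWeight_self] at ih
      rw [TreeEnd.confluent_eq, TreeEnd.confLevel_of_vertex_eq hy, hy, pathWeight_self,
        pathWeight_concat hG f h.1 h.2, one_div, mul_inv, ← one_div, ih, hcons, h.2, hfw, pow_succ]
      field_simp
    · have hl := TreeEnd.confLevel_child hG h hy
      have hc : ξ.confluent y = ξ.confluent x := by
        rw [TreeEnd.confluent_eq, hl, TreeEnd.confluent_eq]
      have s1 := TreeEnd.confLevel_spec hG x ξ
      have s2 := TreeEnd.confLevel_spec hG y ξ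
      have hd := h.2
      rw [hc] at s2
      rw [hc, hl, hcons, mul_assoc, ← ih, pathWeight_cons hG f (a := ξ.confluent x) h.1.symm]
      · ring
      · rw [G.dist_comm (u := y), G.dist_comm (u := x)]; omega

end Tree

/-! ### Children and spheres of a regular tree -/

section Sphere

variable {V : Type*} {G : SimpleGraph V} {o : V}

/-- The finite set of the children of `x`. -/
noncomputable def children (G : SimpleGraph V) [G.LocallyFinite] (o x : V) : Finset V :=
  (G.neighborFinset x).filter (fun y => G.dist o y = G.dist o x + 1)

variable [G.LocallyFinite]

@[simp] theorem mem_children {x y : V} : y ∈ children G o x ↔ IsChild G o x y := by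
  simp [children, IsChild]

theorem neighborFinset_root (hG : G.IsTree) : G.neighborFinset o = children G o o := by
  ext y
  rw [mem_children, SimpleGraph.mem_neighborFinset, adj_iff_isChild (o := o) hG]
  refine or_iff_left fun h => ?_
  have := h.2
  simp at this

theorem sum_neighborFinset (hG : G.IsTree) {M : Type*} [AddCommMonoid M] {x y : V}
    (h : IsChild G o x y) (f : V → M) :
    ∑ z ∈ G.neighborFinset y, f z = f x + ∑ z ∈ children G o y, f z := by
  classical
  have : G.neighborFinset y = insert x (children G o y) := by
    ext z
    rw [Finset.mem_insert, mem_children, SimpleGraph.mem_neighborFinset,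
      adj_iff_isChild (o := o) hG, or_comm]
    refine or_congr_left ⟨fun h' => h'.parent_unique hG h, ?_⟩
    rintro rfl
    exact h
  rw [this, Finset.sum_insert]
  rw [mem_children]
  intro h'
  have h1 := h.2
  have h2 := h'.2
  omega

theorem card_children_root (hG : G.IsTree) {q : ℕ} (hdeg : G.IsRegularOfDegree (q + 1)) :
    (children G o o).card = q + 1 := by
  rw [← neighborFinset_root hG, SimpleGraph.card_neighborFinset_eq_degree, hdeg]

theorem card_children (hG : G.IsTree) {q : ℕ} (hdeg : G.IsRegularOfDegree (q + 1)) {x y : V}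
    (h : IsChild G o x y) : (children G o y).card = q := by
  have h1 := sum_neighborFinset hG h (fun _ => 1)
  rw [← Finset.card_eq_sum_ones, ← Finset.card_eq_sum_ones,
    SimpleGraph.card_neighborFinset_eq_degree, hdeg] at h1
  omega

open Classical in
/-- The sphere of radius `n` around the root. -/
noncomputable def sphere (G : SimpleGraph V) [G.LocallyFinite] (o : V) : ℕ → Finset V
  | 0 => {o}
  | n + 1 => (sphere G o n).biUnion (children G o)

theorem mem_sphere (hG : G.IsTree) {n : ℕ} {x : V} : x ∈ sphere G o n ↔ G.dist o x = n := by
  classical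
  induction n generalizing x with
  | zero =>
    rw [hG.connected.dist_eq_zero_iff, sphere, Finset.mem_singleton, eq_comm]
  | succ n ih =>
    simp only [sphere, Finset.mem_biUnion, ih, mem_children]
    constructor
    · rintro ⟨z, hz, h⟩
      rw [h.2, hz]
    · intro h
      have hne : x ≠ o := by rintro rfl; simp at h
      obtain ⟨z, hz⟩ := exists_parent hG hne
      exact ⟨z, by have := hz.2; omega, hz⟩

theorem sum_sphere_succ (hG : G.IsTree) {M : Type*} [AddCommMonoid M] (f : V → M) (n : ℕ) :
    ∑ y ∈ sphere G o (n + 1), f y = ∑ x ∈ sphere G o n, ∑ y ∈ children G o x, f y := by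
  classical
  rw [sphere, Finset.sum_biUnion]
  intro x _ x' _ hne
  rw [Function.onFun, Finset.disjoint_left]
  intro y hy hy'
  rw [mem_children] at hy hy'
  exact hne (hy.parent_unique hG hy')

theorem finsum_sphere (hG : G.IsTree) {M : Type*} [AddCommMonoid M] (f : V → M) (n : ℕ) :
    ∑ᶠ x ∈ {x : V | G.dist o x = n}, f x = ∑ x ∈ sphere G o n, f x := by
  have : {x : V | G.dist o x = n} = (sphere G o n : Set V) := by
    ext x; simp [mem_sphere hG]
  rw [this, finsum_mem_coe_finset]

theorem countable_of_isTree (hG : G.IsTree) : Countable V := by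
  rcases isEmpty_or_nonempty V with h | ⟨⟨o⟩⟩
  · infer_instance
  · have : (Set.univ : Set V) = ⋃ n, (sphere G o n : Set V) := by
      ext x; simp [mem_sphere hG]
    rw [← Set.countable_univ_iff, this]
    exact Set.countable_iUnion fun n => (sphere G o n).countable_toSet

/-! ### Integration against distributions -/

theorem IsDistribution.sum_children {ν : V → ℂ} (h : IsDistribution G o ν) (x : V) :
    ∑ y ∈ children G o x, ν y = ν x := (h x).symm

theorem IsDistribution.sum_sphere_root (hG : G.IsTree) {ν : V → ℂ} (h : IsDistribution G o ν)
    (n : ℕ) : ∑ z ∈ sphere G o n, ν z = ν o := by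
  induction n with
  | zero => simp [sphere]
  | succ n ih => rw [sum_sphere_succ hG, ← ih]; exact Finset.sum_congr rfl fun x _ => h.sum_children x

variable {e : V → TreeEnd G o}

omit [G.LocallyFinite] in
theorem vertex_section_child (hG : G.IsTree) (he : ∀ z, e z ∈ TreeEnd.arc G o z) {x z : V}
    (h : IsChild G o x z) {m : ℕ} (hm : m ≤ G.dist o x) :
    (e z).vertex m = (e x).vertex m := by
  refine TreeEnd.vertex_eq_of_le hG ?_ hm
  rw [TreeEnd.vertex_of_isChild hG h ((TreeEnd.mem_arc hG).1 (he z)),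
    (TreeEnd.mem_arc hG).1 (he x)]

open Classical in
/-- The mass of an arc is the total mass of its part in a sphere further out. -/
theorem IsDistribution.sum_sphere_descendants (hG : G.IsTree) {ν : V → ℂ}
    (h : IsDistribution G o ν) (he : ∀ z, e z ∈ TreeEnd.arc G o z) (y : V) {n : ℕ}
    (hn : G.dist o y ≤ n) :
    ∑ z ∈ sphere G o n, (if (e z).vertex (G.dist o y) = y then ν z else 0) = ν y := by
  induction n, hn using Nat.le_induction with
  | base =>
    rw [Finset.sum_eq_single_of_mem y ((mem_sphere hG).2 rfl)]
    · rw [if_pos ((TreeEnd.mem_arc hG).1 (he y))]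
    · intro z hz hne
      rw [mem_sphere hG] at hz
      rw [← hz, (TreeEnd.mem_arc hG).1 (he z), if_neg hne]
  | succ n hn ih =>
    rw [sum_sphere_succ hG]
    refine Eq.trans (Finset.sum_congr rfl fun x hx => ?_) ih
    rw [mem_sphere hG] at hx
    rw [← h.sum_children x]
    by_cases hc : (e x).vertex (G.dist o y) = y
    · rw [if_pos hc]
      refine Finset.sum_congr rfl fun z hz => ?_
      rw [vertex_section_child hG he (mem_children.1 hz) (by omega), if_pos hc]
    · rw [if_neg hc]
      refine Finset.sum_eq_zero fun z hz => ?_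
      rw [vertex_section_child hG he (mem_children.1 hz) (by omega), if_neg hc]

omit [G.LocallyFinite] in
theorem confLevel_eq_of_mem_arc (hG : G.IsTree) {x z : V} (h : G.dist o x ≤ G.dist o z)
    {ξ η : TreeEnd G o} (hξ : ξ ∈ TreeEnd.arc G o z) (hη : η ∈ TreeEnd.arc G o z) :
    ξ.confLevel x = η.confLevel x := by
  have hv : ∀ m ≤ G.dist o z, ξ.vertex m = η.vertex m := fun m hm =>
    TreeEnd.vertex_eq_of_le hG
      (((TreeEnd.mem_arc hG).1 hξ).trans ((TreeEnd.mem_arc hG).1 hη).symm) hm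
  induction x using tree_induction (o := o) hG with
  | root => simp
  | child x y hxy ih =>
    by_cases hy : ξ.vertex (G.dist o y) = y
    · rw [TreeEnd.confLevel_of_vertex_eq hy, TreeEnd.confLevel_of_vertex_eq (by rwa [← hv _ h])]
    · rw [TreeEnd.confLevel_child hG hxy hy, TreeEnd.confLevel_child hG hxy (by rwa [← hv _ h])]
      exact ih (by have := hxy.2; omega)

/-- `∫ u^{|x ∧ η|} dν(η)`, evaluated at level `n`, where the end `e z` stands for the arc of `z`. -/
noncomputable def sphereSum (u : ℂ) (ν : V → ℂ) (e : V → TreeEnd G o) (x : V) (n : ℕ) : ℂ :=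
  ∑ z ∈ sphere G o n, u ^ (e z).confLevel x * ν z

theorem sphereSum_root (hG : G.IsTree) {u : ℂ} {ν : V → ℂ} (h : IsDistribution G o ν) (n : ℕ) :
    sphereSum u ν e o n = ν o := by
  simp [sphereSum, h.sum_sphere_root hG]

/-- Passing to a child `y` raises the confluent level exactly on the arc of `y`. -/
theorem sphereSum_child (hG : G.IsTree) {u : ℂ} {ν : V → ℂ} (h : IsDistribution G o ν)
    (he : ∀ z, e z ∈ TreeEnd.arc G o z) {x y : V} (hxy : IsChild G o x y) {n : ℕ}
    (hn : G.dist o y ≤ n) : sphereSum u ν e y n =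
      sphereSum u ν e x n + (u ^ G.dist o y - u ^ G.dist o x) * ν y := by
  classical
  rw [← h.sum_sphere_descendants hG he y hn, sphereSum, sphereSum, Finset.mul_sum,
    ← Finset.sum_add_distrib]
  refine Finset.sum_congr rfl fun z _ => ?_
  by_cases hy : (e z).vertex (G.dist o y) = y
  · rw [if_pos hy, TreeEnd.confLevel_of_vertex_eq hy,
      TreeEnd.confLevel_of_vertex_eq (TreeEnd.vertex_of_isChild hG hxy hy)]
    ring
  · rw [if_neg hy, TreeEnd.confLevel_child hG hxy hy]
    ring

/-- The integral of a locally constant function can be computed at every sufficiently deep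
level. -/
theorem HasDistIntegral.eq_sum (hG : G.IsTree) {ν : V → ℂ} (h : IsDistribution G o ν)
    (he : ∀ z, e z ∈ TreeEnd.arc G o z) {φ : TreeEnd G o → ℂ} {I : ℂ}
    (hI : HasDistIntegral ν φ I) :
    ∃ n, ∀ m ≥ n, I = ∑ z ∈ sphere G o m, φ (e z) * ν z := by
  obtain ⟨n, c, hc, hI⟩ := hI
  rw [finsum_sphere hG] at hI
  have key : ∀ m ≥ n, (∀ x, G.dist o x = m → ∀ ξ ∈ TreeEnd.arc G o x, φ ξ = φ (e x)) ∧
      I = ∑ z ∈ sphere G o m, φ (e z) * ν z := by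
    intro m hm
    induction m, hm using Nat.le_induction with
    | base =>
      refine ⟨fun x hx ξ hξ => by rw [hc x hx ξ hξ, hc x hx _ (he x)], ?_⟩
      rw [hI]
      refine Finset.sum_congr rfl fun z hz => ?_
      rw [hc z ((mem_sphere hG).1 hz) _ (he z)]
    | succ m hm ih =>
      have hcong : ∀ x z, G.dist o x = m → IsChild G o x z → ∀ ξ ∈ TreeEnd.arc G o z,
          φ ξ = φ (e x) := fun x z hx h ξ hξ => ih.1 x hx ξ (TreeEnd.arc_child_subset hG h hξ)
      constructor
      · intro z hz ξ hξ
        have hne : z ≠ o := by rintro rfl; simp at hz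
        obtain ⟨x, hx⟩ := exists_parent hG hne
        have hxm : G.dist o x = m := by have := hx.2; omega
        rw [hcong x z hxm hx ξ hξ, hcong x z hxm hx _ (he z)]
      · rw [ih.2, sum_sphere_succ hG]
        refine Finset.sum_congr rfl fun x hx => ?_
        rw [← h.sum_children x, Finset.mul_sum]
        refine Finset.sum_congr rfl fun z hz => ?_
        rw [hcong x z ((mem_sphere hG).1 hx) (mem_children.1 hz) _ (he z)]
  exact ⟨n, fun m hm => (key m hm).2⟩

/-! ### Representing a function by a distribution -/

open Classical in
/-- The distribution with `H(x) = ∫ u^{|x ∧ η|} dν(η)`; its values are forced by the increments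
of `H` along the edges. -/
noncomputable def distOf (G : SimpleGraph V) (o : V) (u : ℂ) (H : V → ℂ) (y : V) : ℂ :=
  if h : ∃ x, IsChild G o x y then (H y - H h.choose) / (u ^ G.dist o y - u ^ (G.dist o y - 1))
  else H y

omit [G.LocallyFinite] in
theorem distOf_root (u : ℂ) (H : V → ℂ) : distOf G o u H o = H o := by
  rw [distOf, dif_neg]
  rintro ⟨x, hx⟩
  have := hx.2
  simp at this

omit [G.LocallyFinite] in
theorem distOf_child (hG : G.IsTree) (u : ℂ) (H : V → ℂ) {x y : V} (h : IsChild G o x y) :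
    distOf G o u H y = (H y - H x) / (u ^ G.dist o y - u ^ G.dist o x) := by
  have h' : ∃ x, IsChild G o x y := ⟨x, h⟩
  rw [distOf, dif_pos h', h'.choose_spec.parent_unique hG h, h.2, Nat.add_sub_cancel]

/-- The equation which says that `x ↦ F(x, o) H(x)` is `λ`-harmonic, for `u = 1 / (F₊ F₋)`. -/
def IsReducedHarmonic {𝕜 : Type*} [Field 𝕜] (G : SimpleGraph V) [G.LocallyFinite] (o : V) (q : ℕ)
    (u : 𝕜) (H : V → 𝕜) : Prop :=
  ∑ y ∈ children G o o, H y = (q + u) * H o ∧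
    ∀ x y, IsChild G o x y → ∑ z ∈ children G o y, H z + u * H x = (q + u) * H y

omit [G.LocallyFinite] in
theorem pow_dist_sub_ne {u : ℂ} (hu₀ : u ≠ 0) (hu₁ : u ≠ 1) {x y : V} (h : IsChild G o x y) :
    u ^ G.dist o y - u ^ G.dist o x ≠ 0 := by
  rw [h.2, pow_succ, ← mul_sub_one]
  exact mul_ne_zero (pow_ne_zero _ hu₀) (sub_ne_zero.2 hu₁)

theorem isDistribution_distOf (hG : G.IsTree) {q : ℕ} (hdeg : G.IsRegularOfDegree (q + 1))
    {u : ℂ} (hu₀ : u ≠ 0) (hu₁ : u ≠ 1) {H : V → ℂ} (hH : IsReducedHarmonic G o q u H) :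
    IsDistribution G o (distOf G o u H) := by
  intro y
  change _ = ∑ z ∈ children G o y, _
  rw [Finset.sum_congr rfl fun z hz => distOf_child hG u H (mem_children.1 hz)]
  rw [Finset.sum_congr rfl (g := fun z => (H z - H y) / (u ^ (G.dist o y + 1) - u ^ G.dist o y))
    fun z hz => by rw [(mem_children.1 hz).2], ← Finset.sum_div, Finset.sum_sub_distrib,
    Finset.sum_const, nsmul_eq_mul]
  have hu₁' : u - 1 ≠ 0 := sub_ne_zero.2 hu₁
  by_cases hy : y = o
  · subst hy
    rw [distOf_root, hH.1, card_children_root hG hdeg]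
    simp
    field_simp
    ring
  · obtain ⟨x, hx⟩ := exists_parent hG hy
    rw [distOf_child hG u H hx, card_children hG hdeg hx,
      eq_sub_of_add_eq (hH.2 x y hx), hx.2]
    have e1 : u ^ (G.dist o x + 1) - u ^ G.dist o x = u ^ G.dist o x * (u - 1) := by ring
    have e2 : u ^ (G.dist o x + 1 + 1) - u ^ (G.dist o x + 1) = u ^ G.dist o x * u * (u - 1) := by
      ring
    rw [e1, e2]
    have := pow_ne_zero (G.dist o x) hu₀
    field_simp
    ring

/-- A kernel of the form `g(x) u^{|x ∧ η|}` represents the functions `g H`, with `H` satisfying the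
reduced harmonic equation, by unique distributions. -/
theorem represents_iff_eq_distOf (hG : G.IsTree) {q : ℕ} (hdeg : G.IsRegularOfDegree (q + 1))
    (he : ∀ z, e z ∈ TreeEnd.arc G o z)
    {u : ℂ} (hu₀ : u ≠ 0) (hu₁ : u ≠ 1) {H : V → ℂ} (hH : IsReducedHarmonic G o q u H)
    {g : V → ℂ} (hg : ∀ x, g x ≠ 0) {k : V → TreeEnd G o → ℂ}
    (hk : ∀ x η, k x η = g x * u ^ η.confLevel x) {h : V → ℂ} (hh : ∀ x, h x = g x * H x)
    (ν : V → ℂ) : Represents G o k ν h ↔ ν = distOf G o u H := by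
  constructor
  · rintro ⟨hν, hI⟩
    have key : ∀ x, ∃ n, ∀ m ≥ n, H x = sphereSum u ν e x m := by
      intro x
      obtain ⟨n, hn⟩ := (hI x).eq_sum hG hν he
      refine ⟨n, fun m hm => mul_left_cancel₀ (hg x) ?_⟩
      rw [← hh, hn m hm, sphereSum, Finset.mul_sum]
      refine Finset.sum_congr rfl fun z _ => ?_
      rw [hk, mul_assoc]
    funext y
    by_cases hy : y = o
    · subst hy
      obtain ⟨n, hn⟩ := key y
      rw [distOf_root, hn n le_rfl, sphereSum_root hG hν]
    · obtain ⟨x, hx⟩ := exists_parent hG hy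
      obtain ⟨n, hn⟩ := key x
      obtain ⟨n', hn'⟩ := key y
      rw [distOf_child hG u H hx, eq_div_iff (pow_dist_sub_ne hu₀ hu₁ hx),
        hn (max (max n n') (G.dist o y)) (by simp), hn' (max (max n n') (G.dist o y)) (by simp),
        sphereSum_child hG hν he hx (by simp)]
      ring
  · rintro rfl
    have hν := isDistribution_distOf hG hdeg hu₀ hu₁ hH
    have key : ∀ x n, G.dist o x ≤ n → sphereSum u (distOf G o u H) e x n = H x := by
      intro x
      induction x using tree_induction (o := o) hG with
      | root => intro n _; rw [sphereSum_root hG hν, distOf_root]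
      | child x y hxy ih =>
        intro n hn
        rw [sphereSum_child hG hν he hxy hn, ih n (by have := hxy.2; omega),
          distOf_child hG u H hxy, mul_div_cancel₀ _ (pow_dist_sub_ne hu₀ hu₁ hxy)]
        ring
    refine ⟨hν, fun x => ⟨G.dist o x, fun z => k x (e z), fun z hz ξ hξ => ?_, ?_⟩⟩
    · change k x ξ = k x (e z)
      rw [hk, hk, confLevel_eq_of_mem_arc hG hz.ge hξ (he z)]
    · rw [finsum_sphere hG, hh, ← key x _ le_rfl, sphereSum, Finset.mul_sum]
      refine Finset.sum_congr rfl fun z _ => ?_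
      change _ = k x (e z) * _
      rw [hk, mul_assoc]

/-! ### The twin kernel in reduced form -/

/-- The quotient of the twin kernel `K̃(x, ξ | λ)` by `F(x, o | λ)`, for `u = 1 / (F₊ F₋)`. -/
noncomputable def twinRatio {𝕜 : Type*} [Field 𝕜] (q : ℕ) (u : 𝕜) (ξ : TreeEnd G o) (x : V) : 𝕜 :=
  (u / q) ^ G.dist o x * (q ^ 2 / u) ^ ξ.confLevel x

section

variable {𝕜 : Type*} [Field 𝕜] {q : ℕ} {u : 𝕜} (ξ : TreeEnd G o)

omit [G.LocallyFinite] in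
theorem twinRatio_child_of_ne (hG : G.IsTree) {x y : V} (h : IsChild G o x y)
    (hy : ξ.vertex (G.dist o y) ≠ y) : twinRatio q u ξ y = u / q * twinRatio q u ξ x := by
  rw [twinRatio, twinRatio, TreeEnd.confLevel_child hG h hy, h.2]
  ring

omit [G.LocallyFinite] in
theorem twinRatio_vertex (hG : G.IsTree) (hq : (q : 𝕜) ≠ 0) (hu₀ : u ≠ 0) (n : ℕ) :
    twinRatio q u ξ (ξ.vertex n) = (q : 𝕜) ^ n := by
  rw [twinRatio, TreeEnd.confLevel_of_vertex_eq (by rw [TreeEnd.dist_vertex hG]),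
    TreeEnd.dist_vertex hG, ← mul_pow]
  congr 1
  field_simp

omit [G.LocallyFinite] in
@[simp] theorem twinRatio_root : twinRatio q u ξ o = 1 := by
  simp [twinRatio]

theorem sum_children_twinRatio_vertex (hG : G.IsTree) (hq : (q : 𝕜) ≠ 0) (hu₀ : u ≠ 0) (n : ℕ) :
    ∑ z ∈ children G o (ξ.vertex n), twinRatio q u ξ z =
      (q : 𝕜) ^ n * (q + (((children G o (ξ.vertex n)).card : 𝕜) - 1) * (u / q)) := by
  classical
  have hmem : ξ.vertex (n + 1) ∈ children G o (ξ.vertex n) :=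
    mem_children.2 (ξ.isChild_vertex hG n)
  rw [← Finset.add_sum_erase _ _ hmem, twinRatio_vertex ξ hG hq hu₀,
    Finset.sum_congr rfl (g := fun _ => u / q * (q : 𝕜) ^ n), Finset.sum_const,
    Finset.card_erase_of_mem hmem, nsmul_eq_mul, Nat.cast_pred (Finset.card_pos.2 ⟨_, hmem⟩)]
  · ring
  · intro z hz
    rw [Finset.mem_erase, mem_children] at hz
    rw [twinRatio_child_of_ne ξ hG hz.2, twinRatio_vertex ξ hG hq hu₀]
    rw [hz.2.2, TreeEnd.dist_vertex hG]
    exact hz.1.symm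

theorem isReducedHarmonic_twinRatio (hG : G.IsTree) (hdeg : G.IsRegularOfDegree (q + 1))
    (hq : (q : 𝕜) ≠ 0) (hu₀ : u ≠ 0) : IsReducedHarmonic G o q u (twinRatio q u ξ) := by
  constructor
  · have := sum_children_twinRatio_vertex ξ hG hq hu₀ 0
    rw [ξ.vertex_zero, card_children_root hG hdeg] at this
    rw [this, twinRatio_root]
    push_cast
    field_simp
    ring
  · intro x y hxy
    by_cases hy : ξ.vertex (G.dist o y) = y
    · have hx := TreeEnd.vertex_of_isChild hG hxy hy
      have hs := sum_children_twinRatio_vertex ξ hG hq hu₀ (G.dist o y)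
      have e1 := twinRatio_vertex ξ hG hq hu₀ (G.dist o y)
      have e2 := twinRatio_vertex ξ hG hq hu₀ (G.dist o x)
      rw [hy] at hs e1
      rw [hx] at e2
      rw [hs, e1, e2, card_children hG hdeg hxy, hxy.2, pow_succ]
      field_simp
      ring
    · rw [Finset.sum_congr rfl (g := fun _ => u / q * twinRatio q u ξ y), Finset.sum_const,
        card_children hG hdeg hxy, nsmul_eq_mul, twinRatio_child_of_ne ξ hG hxy hy]
      · field_simp
        ring
      · intro z hz
        rw [mem_children] at hz
        exact twinRatio_child_of_ne ξ hG hz fun h => hy (TreeEnd.vertex_of_isChild hG hz h)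

omit [G.LocallyFinite] in
/-- On the ray of `ξ`, the representing distribution behaves like `(q / u)ⁿ`. -/
theorem distOf_twinRatio_vertex {u : ℂ} (hG : G.IsTree) (hq : q ≠ 0) (hu₀ : u ≠ 0) (n : ℕ) :
    distOf G o u (twinRatio q u ξ) (ξ.vertex (n + 1)) = (q / u) ^ n * ((q - 1) / (u - 1)) := by
  have hq' : (q : ℂ) ≠ 0 := by exact_mod_cast hq
  rw [distOf_child hG _ _ (ξ.isChild_vertex hG n), twinRatio_vertex ξ hG hq' hu₀,
    twinRatio_vertex ξ hG hq' hu₀, TreeEnd.dist_vertex hG, TreeEnd.dist_vertex hG,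
    pow_succ, pow_succ, ← mul_sub_one, ← mul_sub_one, mul_div_mul_comm, div_pow]

end

end Sphere

/-! ### Topology and measurable structure of the boundary -/

section BoundaryTopology

variable {V : Type*} {G : SimpleGraph V} {o : V}

namespace TreeEnd

theorem isOpen_arc (x : V) : IsOpen (arc G o x) :=
  TopologicalSpace.isOpen_generateFrom_of_mem ⟨x, rfl⟩

theorem measurableSet_arc (x : V) : MeasurableSet (arc G o x) := (isOpen_arc x).measurableSet

theorem disjoint_arc (hG : G.IsTree) {x y : V} (hd : G.dist o x = G.dist o y) (h : x ≠ y) :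
    Disjoint (arc G o x) (arc G o y) := by
  rw [Set.disjoint_left]
  intro ξ hx hy
  rw [mem_arc hG] at hx hy
  exact h (by rw [← hx, hd, hy])

theorem antitone_arc_vertex (hG : G.IsTree) (ξ : TreeEnd G o) :
    Antitone fun n => arc G o (ξ.vertex n) :=
  antitone_nat_of_succ_le fun n => arc_child_subset hG (ξ.isChild_vertex hG n)

theorem mem_arc_vertex (hG : G.IsTree) {ξ η : TreeEnd G o} {n : ℕ} :
    η ∈ arc G o (ξ.vertex n) ↔ η.vertex n = ξ.vertex n := by
  rw [mem_arc hG, dist_vertex hG]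

theorem iInter_arc_vertex (hG : G.IsTree) (ξ : TreeEnd G o) :
    ⋂ n, arc G o (ξ.vertex n) = {ξ} := by
  ext η
  simp only [Set.mem_iInter, mem_arc_vertex hG, Set.mem_singleton_iff]
  exact ⟨fun h => TreeEnd.ext (funext h), fun h n => by rw [h]⟩

/-- The arcs along a ray form a neighbourhood basis of its end. -/
theorem exists_arc_subset (hG : G.IsTree) {U : Set (TreeEnd G o)} (hU : IsOpen U)
    {η : TreeEnd G o} (hη : η ∈ U) : ∃ n, arc G o (η.vertex n) ⊆ U := by
  induction hU with
  | basic s hs =>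
    obtain ⟨x, rfl⟩ := hs
    obtain ⟨n, rfl⟩ := hη
    exact ⟨n, subset_rfl⟩
  | univ => exact ⟨0, Set.subset_univ _⟩
  | inter s t _ _ ihs iht =>
    obtain ⟨n, hn⟩ := ihs hη.1
    obtain ⟨m, hm⟩ := iht hη.2
    exact ⟨max n m, Set.subset_inter ((antitone_arc_vertex hG η (le_max_left _ _)).trans hn)
      ((antitone_arc_vertex hG η (le_max_right _ _)).trans hm)⟩
  | sUnion S _ ih =>
    obtain ⟨s, hs, h⟩ := hη
    obtain ⟨n, hn⟩ := ih s hs h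
    exact ⟨n, hn.trans (Set.subset_sUnion_of_mem hs)⟩

/-- A map into the boundary is measurable as soon as the preimages of the arcs are. -/
theorem measurable_of_arc [Countable V] {Ω : Type*} [MeasurableSpace Ω] {f : Ω → TreeEnd G o}
    (h : ∀ x, MeasurableSet (f ⁻¹' arc G o x)) : Measurable f := by
  have : SecondCountableTopology (TreeEnd G o) :=
    ⟨⟨Set.range (arc G o), Set.countable_range _, rfl⟩⟩
  have hb := borel_eq_generateFrom_of_subbasis (α := TreeEnd G o) (s := Set.range (arc G o)) rfl
  have key : @Measurable Ω (TreeEnd G o) _ (MeasurableSpace.generateFrom (Set.range (arc G o))) f :=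
    measurable_generateFrom (by rintro _ ⟨x, rfl⟩; exact h x)
  rwa [← hb] at key

theorem arc_eq_biUnion [G.LocallyFinite] (hG : G.IsTree) (x : V) :
    arc G o x = ⋃ y ∈ children G o x, arc G o y := by
  ext η
  simp only [Set.mem_iUnion, mem_children, exists_prop]
  constructor
  · rintro ⟨n, rfl⟩
    exact ⟨η.vertex (n + 1), η.isChild_vertex hG n, n + 1, rfl⟩
  · rintro ⟨y, hy, hη⟩
    exact arc_child_subset hG hy hη

theorem setIntegral_arc [G.LocallyFinite] (hG : G.IsTree) {m : Measure (TreeEnd G o)}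
    {f : TreeEnd G o → ℂ} (hf : Integrable f m) (x : V) :
    ∫ η in arc G o x, f η ∂m = ∑ y ∈ children G o x, ∫ η in arc G o y, f η ∂m := by
  rw [arc_eq_biUnion hG x, integral_biUnion_finset _ (fun y _ => measurableSet_arc y) ?_
    fun y _ => hf.integrableOn]
  intro y hy y' hy' hne
  rw [Finset.mem_coe, mem_children] at hy hy'
  exact disjoint_arc hG (by rw [hy.2, hy'.2]) hne

end TreeEnd

/-! ### The uniform measure on the boundary -/

section RandomRay

variable {A : Type*} (step : V → A → V)

/-- The vertices of the path from `o` which takes the steps prescribed by `ω`. -/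
def stepVertex (o : V) (ω : ℕ → A) : ℕ → V
  | 0 => o
  | n + 1 => step (stepVertex o ω n) (ω n)

variable {step}

theorem dist_stepVertex (hstep : ∀ x a, IsChild G o x (step x a)) (ω : ℕ → A) (n : ℕ) :
    G.dist o (stepVertex step o ω n) = n := by
  induction n with
  | zero => simp [stepVertex]
  | succ n ih => rw [stepVertex, (hstep _ _).2, ih]

/-- The end reached by steps which always lead away from the root. -/
def stepEnd (hstep : ∀ x a, IsChild G o x (step x a)) (ω : ℕ → A) : TreeEnd G o where
  vertex := stepVertex step o ω
  vertex_zero := rfl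
  adj n := (hstep _ _).1
  no_backtrack n h := by
    have := congrArg (G.dist o) h
    rw [dist_stepVertex hstep, dist_stepVertex hstep] at this
    omega

theorem stepEnd_mem_arc_child (hG : G.IsTree) (hstep : ∀ x a, IsChild G o x (step x a)) {x y : V}
    (h : IsChild G o x y) (ω : ℕ → A) : stepEnd hstep ω ∈ TreeEnd.arc G o y ↔
      stepEnd hstep ω ∈ TreeEnd.arc G o x ∧ step x (ω (G.dist o x)) = y := by
  constructor
  · intro hy
    have hx := TreeEnd.arc_child_subset hG h hy
    refine ⟨hx, ?_⟩
    rw [TreeEnd.mem_arc hG] at hx hy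
    rw [h.2] at hy
    change step ((stepEnd hstep ω).vertex (G.dist o x)) _ = y at hy
    rwa [hx] at hy
  · rintro ⟨hx, hy⟩
    rw [TreeEnd.mem_arc hG] at hx ⊢
    rw [h.2]
    change step ((stepEnd hstep ω).vertex (G.dist o x)) _ = y
    rwa [hx]

/-- The event that the random ray passes through `y` is a cylinder. -/
theorem exists_preimage_arc_eq_pi (hG : G.IsTree) (hstep : ∀ x a, IsChild G o x (step x a))
    (y : V) : ∃ t : ℕ → Set A,
      stepEnd hstep ⁻¹' TreeEnd.arc G o y = Set.pi (Finset.range (G.dist o y)) t := by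
  induction y using tree_induction (o := o) hG with
  | root => exact ⟨fun _ => Set.univ, by simp [TreeEnd.arc_root]⟩
  | child x y h ih =>
    obtain ⟨t, ht⟩ := ih
    refine ⟨Function.update t (G.dist o x) {a | step x a = y}, ?_⟩
    ext ω
    have h1 : stepEnd hstep ω ∈ TreeEnd.arc G o x ↔ ω ∈ Set.pi (Finset.range (G.dist o x)) t := by
      rw [← ht]; rfl
    rw [Set.mem_preimage, stepEnd_mem_arc_child hG hstep h, h1, h.2]
    simp only [Set.mem_pi, Finset.mem_coe, Finset.mem_range]
    constructor
    · rintro ⟨h2, h3⟩ i hi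
      rcases Nat.lt_succ_iff_lt_or_eq.1 hi with h' | rfl
      · rw [Function.update_of_ne h'.ne]
        exact h2 i h'
      · rw [Function.update_self]
        exact h3
    · intro h2
      refine ⟨fun i hi => ?_, ?_⟩
      · have := h2 i (by omega)
        rwa [Function.update_of_ne hi.ne] at this
      · have := h2 _ (Nat.lt_succ_self _)
        rwa [Function.update_self] at this

theorem infinitePi_preimage_arc_child (hG : G.IsTree) [MeasurableSpace A] [Countable A]
    [MeasurableSingletonClass A] (P : Measure A) [IsProbabilityMeasure P]
    (hstep : ∀ x a, IsChild G o x (step x a)) {x y : V} (h : IsChild G o x y) :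
    Measure.infinitePi (fun _ : ℕ => P) (stepEnd hstep ⁻¹' TreeEnd.arc G o y) =
      Measure.infinitePi (fun _ : ℕ => P) (stepEnd hstep ⁻¹' TreeEnd.arc G o x) *
        P {a | step x a = y} := by
  obtain ⟨t, ht⟩ := exists_preimage_arc_eq_pi hG hstep x
  have ht' : stepEnd hstep ⁻¹' TreeEnd.arc G o y = Set.pi (Finset.range (G.dist o x + 1))
      (Function.update t (G.dist o x) {a | step x a = y}) := by
    ext ω
    have h1 : stepEnd hstep ω ∈ TreeEnd.arc G o x ↔ ω ∈ Set.pi (Finset.range (G.dist o x)) t := by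
      rw [← ht]; rfl
    rw [Set.mem_preimage, stepEnd_mem_arc_child hG hstep h, h1, Finset.range_add_one,
      Finset.coe_insert, Set.insert_pi, Function.update_self, and_comm]
    refine and_congr Iff.rfl (forall₂_congr fun i hi => ?_)
    rw [Function.update_of_ne]
    simp at hi
    omega
  rw [ht, ht', Measure.infinitePi_pi _ (fun _ _ => Set.Countable.measurableSet (Set.to_countable _)),
    Measure.infinitePi_pi _ (fun _ _ => Set.Countable.measurableSet (Set.to_countable _)),
    Finset.prod_range_succ, Function.update_self]
  congr 1
  refine Finset.prod_congr rfl fun i hi => ?_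
  rw [Function.update_of_ne (Finset.mem_range.1 hi).ne]

end RandomRay

variable [G.LocallyFinite]

/-- A single random variable which picks, at every vertex, a uniformly distributed child: the root
uses the first component and the other vertices the second one. -/
theorem exists_uniform_step (hG : G.IsTree) {q : ℕ} (hq : q ≠ 0)
    (hdeg : G.IsRegularOfDegree (q + 1)) :
    ∃ (P : Measure (Fin (q + 1) × Fin q)) (step : V → Fin (q + 1) × Fin q → V),
      IsProbabilityMeasure P ∧ (∀ x a, IsChild G o x (step x a)) ∧
      ∀ x y, IsChild G o x y → (children G o x).card * P {a | step x a = y} = 1 := by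
  classical
  have : Nonempty (Fin q) := ⟨⟨0, Nat.pos_of_ne_zero hq⟩⟩
  let P₁ := (PMF.uniformOfFintype (Fin (q + 1))).toMeasure
  let P₂ := (PMF.uniformOfFintype (Fin q)).toMeasure
  have hP₁ : ∀ i, P₁ {i} = ((q + 1 : ℕ) : ENNReal)⁻¹ := fun i => by
    simp [P₁]
  have hP₂ : ∀ i, P₂ {i} = (q : ENNReal)⁻¹ := fun i => by
    simp [P₂]
  have hs : ∀ x, ∃ s : Fin (q + 1) × Fin q → V, (∀ a, IsChild G o x (s a)) ∧
      ∀ y, IsChild G o x y → (children G o x).card * (P₁.prod P₂) {a | s a = y} = 1 := by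
    intro x
    by_cases hx : x = o
    · subst hx
      have hc := card_children_root (o := x) hG hdeg
      let e := Finset.equivFinOfCardEq hc
      refine ⟨fun a => e.symm a.1, fun a => mem_children.1 (e.symm a.1).2, fun y hy => ?_⟩
      have : {a : Fin (q + 1) × Fin q | (e.symm a.1 : V) = y} =
          {e ⟨y, mem_children.2 hy⟩} ×ˢ Set.univ := by
        ext a
        simp [← Equiv.symm_apply_eq, Subtype.ext_iff]
      rw [this, Measure.prod_prod, hP₁, measure_univ, mul_one, hc,
        ENNReal.mul_inv_cancel (by simp) (ENNReal.natCast_ne_top _)]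
    · obtain ⟨z, hz⟩ := exists_parent hG hx
      have hc := card_children hG hdeg hz
      let e := Finset.equivFinOfCardEq hc
      refine ⟨fun a => e.symm a.2, fun a => mem_children.1 (e.symm a.2).2, fun y hy => ?_⟩
      have : {a : Fin (q + 1) × Fin q | (e.symm a.2 : V) = y} =
          Set.univ ×ˢ {e ⟨y, mem_children.2 hy⟩} := by
        ext a
        simp [← Equiv.symm_apply_eq, Subtype.ext_iff]
      rw [this, Measure.prod_prod, hP₂, measure_univ, one_mul, hc,
        ENNReal.mul_inv_cancel (by simpa using hq) (by simp)]
  choose s hs₁ hs₂ using hs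
  exact ⟨P₁.prod P₂, s, inferInstance, hs₁, hs₂⟩

/-- The uniform distribution on the boundary of the regular tree. -/
theorem exists_uniform_measure (hG : G.IsTree) {q : ℕ} (hq : q ≠ 0)
    (hdeg : G.IsRegularOfDegree (q + 1)) :
    ∃ m : Measure (TreeEnd G o), IsProbabilityMeasure m ∧
      ∀ x y, IsChild G o x y → m.real (TreeEnd.arc G o y) = ((q + 1) * (q : ℝ) ^ G.dist o x)⁻¹ := by
  obtain ⟨P, step, hP, hstep, hu⟩ := exists_uniform_step (o := o) hG hq hdeg
  have := countable_of_isTree hG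
  have hq' : (q : ℝ) ≠ 0 := by exact_mod_cast hq
  have hmeas : Measurable (stepEnd hstep) := TreeEnd.measurable_of_arc fun x => by
    obtain ⟨t, ht⟩ := exists_preimage_arc_eq_pi hG hstep x
    rw [ht]
    exact MeasurableSet.pi (Finset.countable_toSet _)
      fun _ _ => Set.Countable.measurableSet (Set.to_countable _)
  let m := (Measure.infinitePi (fun _ : ℕ => P)).map (stepEnd hstep)
  have hm : IsProbabilityMeasure m := Measure.isProbabilityMeasure_map hmeas.aemeasurable
  have hrec : ∀ x y, IsChild G o x y →
      (children G o x).card * m.real (TreeEnd.arc G o y) = m.real (TreeEnd.arc G o x) := by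
    intro x y h
    have h1 : (children G o x).card * m (TreeEnd.arc G o y) = m (TreeEnd.arc G o x) := by
      rw [Measure.map_apply hmeas (TreeEnd.measurableSet_arc _),
        Measure.map_apply hmeas (TreeEnd.measurableSet_arc _),
        infinitePi_preimage_arc_child hG P hstep h, mul_left_comm, hu x y h, mul_one]
    have h2 := congrArg ENNReal.toReal h1
    rw [ENNReal.toReal_mul, ENNReal.toReal_natCast] at h2
    exact h2
  refine ⟨m, hm, fun x => ?_⟩
  induction x using tree_induction (o := o) hG with
  | root =>
    intro y h
    have h1 := hrec o y h
    rw [card_children_root hG hdeg, TreeEnd.arc_root, probReal_univ] at h1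
    rw [SimpleGraph.dist_self, pow_zero, mul_one]
    exact eq_inv_of_mul_eq_one_right (by exact_mod_cast h1)
  | child z x hzx ih =>
    intro y h
    have h1 := hrec x y h
    rw [card_children hG hdeg hzx, ih x hzx] at h1
    rw [eq_div_of_mul_eq hq' ((mul_comm _ _).trans h1), hzx.2, pow_succ]
    have : (q : ℝ) + 1 ≠ 0 := by positivity
    field_simp

omit [G.LocallyFinite] in
theorem measureReal_arc_pos (hG : G.IsTree) {q : ℕ} (hq : q ≠ 0) {m : Measure (TreeEnd G o)}
    [IsProbabilityMeasure m] (hm : ∀ x y, IsChild G o x y →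
      m.real (TreeEnd.arc G o y) = ((q + 1) * (q : ℝ) ^ G.dist o x)⁻¹) (x : V) :
    0 < m.real (TreeEnd.arc G o x) := by
  by_cases hx : x = o
  · subst hx
    simp [TreeEnd.arc_root]
  · obtain ⟨z, hz⟩ := exists_parent hG hx
    rw [hm z x hz]
    have : (0 : ℝ) < q := by exact_mod_cast Nat.pos_of_ne_zero hq
    positivity

/-- Every vertex lies on the ray of some end. -/
theorem exists_section (hG : G.IsTree) {q : ℕ} (hq : q ≠ 0) (hdeg : G.IsRegularOfDegree (q + 1)) :
    ∃ e : V → TreeEnd G o, ∀ z, e z ∈ TreeEnd.arc G o z := by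
  obtain ⟨m, hm, h⟩ := exists_uniform_measure (o := o) hG hq hdeg
  have hne : ∀ z, (TreeEnd.arc G o z).Nonempty := fun z => by
    by_contra hz
    have := measureReal_arc_pos hG hq h z
    rw [Set.not_nonempty_iff_eq_empty.1 hz] at this
    simp at this
  exact ⟨fun z => (hne z).some, fun z => (hne z).some_mem⟩

end BoundaryTopology

/-! ### Densities which depend on the confluent with a fixed ray -/

section Density

variable {V : Type*} {G : SimpleGraph V} {o : V}

open Classical in
/-- The function with value `b k` on `∂T_{ξ_k} ∖ ∂T_{ξ_{k+1}}`, where `ξ_k` are the vertices of the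
ray of `ξ`, and with value `0` at `ξ` itself. -/
noncomputable def rayDensity (ξ : TreeEnd G o) (b : ℕ → ℂ) (η : TreeEnd G o) : ℂ :=
  if η = ξ then 0 else b (sInf {n | η.vertex (n + 1) ≠ ξ.vertex (n + 1)})

variable {ξ : TreeEnd G o} {b : ℕ → ℂ}

@[simp] theorem rayDensity_self : rayDensity ξ b ξ = 0 := if_pos rfl

theorem rayDensity_of_ne (hG : G.IsTree) {η : TreeEnd G o} {k : ℕ}
    (h : η.vertex k = ξ.vertex k) (h' : η.vertex (k + 1) ≠ ξ.vertex (k + 1)) :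
    rayDensity ξ b η = b k := by
  rw [rayDensity, if_neg (fun hη => h' (by rw [hη]))]
  congr 1
  refine le_antisymm (Nat.sInf_le h') (le_csInf ⟨k, h'⟩ fun n hn => ?_)
  by_contra hlt
  exact hn (TreeEnd.vertex_eq_of_le hG h (by omega))

/-- The ends different from `ξ`, sorted by the level at which their rays leave that of `ξ`. -/
theorem iUnion_arc_diff (hG : G.IsTree) :
    (⋃ k, TreeEnd.arc G o (ξ.vertex k) \ TreeEnd.arc G o (ξ.vertex (k + 1))) = {ξ}ᶜ := by
  ext η
  simp only [Set.mem_iUnion, Set.mem_sdiff, TreeEnd.mem_arc_vertex hG, Set.mem_compl_iff,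
    Set.mem_singleton_iff]
  constructor
  · rintro ⟨k, -, hk⟩ rfl
    exact hk rfl
  · intro hne
    by_contra! hcon
    refine hne (TreeEnd.ext (funext fun n => ?_))
    induction n with
    | zero => rw [η.vertex_zero, ξ.vertex_zero]
    | succ n ih => exact hcon n ih

theorem rayDensity_mem (hG : G.IsTree) (ξ η : TreeEnd G o) (b : ℕ → ℂ) :
    rayDensity ξ b η = 0 ∨ ∃ k, rayDensity ξ b η = b k := by
  by_cases h : η = ξ
  · left; rw [h, rayDensity_self]
  · right
    have : η ∈ ({ξ} : Set (TreeEnd G o))ᶜ := h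
    rw [← iUnion_arc_diff hG] at this
    simp only [Set.mem_iUnion, Set.mem_sdiff, TreeEnd.mem_arc_vertex hG] at this
    obtain ⟨k, hk⟩ := this
    exact ⟨k, rayDensity_of_ne hG hk.1 hk.2⟩

theorem integrable_rayDensity (hG : G.IsTree) {m : Measure (TreeEnd G o)} [IsFiniteMeasure m]
    (hb : Summable fun k => ‖b k‖ * m.real (TreeEnd.arc G o (ξ.vertex k))) :
    Integrable (rayDensity ξ b) m := by
  let D : ℕ → Set (TreeEnd G o) := fun k =>
    TreeEnd.arc G o (ξ.vertex k) \ TreeEnd.arc G o (ξ.vertex (k + 1))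
  have hD : ∀ k, MeasurableSet (D k) := fun k =>
    (TreeEnd.measurableSet_arc _).diff (TreeEnd.measurableSet_arc _)
  have hconst : ∀ k, Set.EqOn (rayDensity ξ b) (fun _ => b k) (D k) := fun k η hη => by
    simp only [D, Set.mem_sdiff, TreeEnd.mem_arc_vertex hG] at hη
    exact rayDensity_of_ne hG hη.1 hη.2
  have h1 : IntegrableOn (rayDensity ξ b) (⋃ k, D k) m := by
    refine integrableOn_iUnion_of_summable_integral_norm
      (fun k => (integrableOn_const (C := b k)).congr_fun (hconst k).symm (hD k)) ?_
    refine hb.of_nonneg_of_le (fun k => integral_nonneg fun _ => norm_nonneg _) fun k => ?_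
    rw [setIntegral_congr_fun (hD k) (g := fun _ => ‖b k‖) fun η hη => by rw [hconst k hη],
      setIntegral_const, smul_eq_mul, mul_comm]
    gcongr
    · exact measure_ne_top _ _
    · exact Set.sdiff_subset
  have hms : MeasurableSet ({ξ} : Set (TreeEnd G o)) := by
    rw [← TreeEnd.iInter_arc_vertex hG]
    exact MeasurableSet.iInter fun _ => TreeEnd.measurableSet_arc _
  have h2 : IntegrableOn (rayDensity ξ b) {ξ} m := by
    refine (integrableOn_const (C := (0 : ℂ))).congr_fun (fun η hη => ?_) hms
    rw [Set.mem_singleton_iff.1 hη, rayDensity_self]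
  rw [← integrableOn_univ, ← Set.compl_union_self {ξ}, ← iUnion_arc_diff hG]
  exact h1.union h2

/-- On an arc off the ray of `ξ` the density is constant. -/
theorem rayDensity_of_mem_arc (hG : G.IsTree) {y : V} (hy : ξ.vertex (G.dist o y) ≠ y)
    {η : TreeEnd G o} (hη : η ∈ TreeEnd.arc G o y) :
    rayDensity ξ b η = b (ξ.confLevel y) := by
  suffices h : η.vertex (ξ.confLevel y) = ξ.vertex (ξ.confLevel y) ∧
      η.vertex (ξ.confLevel y + 1) ≠ ξ.vertex (ξ.confLevel y + 1) from
    rayDensity_of_ne hG h.1 h.2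
  induction y using tree_induction (o := o) hG with
  | root => exact absurd (by simp [ξ.vertex_zero]) hy
  | child x y hxy ih =>
    rw [TreeEnd.confLevel_child hG hxy hy]
    by_cases hx : ξ.vertex (G.dist o x) = x
    · have hηx := TreeEnd.arc_child_subset hG hxy hη
      rw [TreeEnd.mem_arc hG] at hη hηx
      rw [TreeEnd.confLevel_of_vertex_eq hx, ← hxy.2, hη, hηx, hx]
      exact ⟨rfl, hy.symm⟩
    · exact ih hx (TreeEnd.arc_child_subset hG hxy hη)

theorem tendsto_setIntegral_rayDensity (hG : G.IsTree) {m : Measure (TreeEnd G o)}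
    (hint : Integrable (rayDensity ξ b) m) :
    Filter.Tendsto (fun n => ∫ η in TreeEnd.arc G o (ξ.vertex n), rayDensity ξ b η ∂m)
      Filter.atTop (nhds 0) := by
  have h := tendsto_setIntegral_of_antitone (μ := m) (f := rayDensity ξ b)
    (fun n => TreeEnd.measurableSet_arc (ξ.vertex n)) (TreeEnd.antitone_arc_vertex hG ξ)
    ⟨0, hint.integrableOn⟩
  rw [TreeEnd.iInter_arc_vertex hG] at h
  have hms : MeasurableSet ({ξ} : Set (TreeEnd G o)) := by
    rw [← TreeEnd.iInter_arc_vertex hG]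
    exact MeasurableSet.iInter fun _ => TreeEnd.measurableSet_arc _
  rwa [setIntegral_congr_fun hms (g := fun _ => (0 : ℂ)) fun η hη => by
    rw [Set.mem_singleton_iff.1 hη, rayDensity_self], integral_zero] at h

/-! ### Extension of the representing distribution to a measure -/

variable [G.LocallyFinite] {q : ℕ} {u : ℂ}

/-- The value of the density, with respect to the uniform measure, on the ends whose rays leave
that of `ξ` at level `k`. -/
noncomputable def densityCoeff (q : ℕ) (u : ℂ) (k : ℕ) : ℂ :=
  (q + 1) * (u - q) / (q * (u - 1)) * (q ^ 2 / u) ^ k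

theorem ne_of_natCast_lt_norm (hq : 2 ≤ q) (hu : (q : ℝ) < ‖u‖) : u ≠ 0 ∧ u ≠ 1 ∧ u ≠ q := by
  have h2 : (2 : ℝ) ≤ q := by exact_mod_cast hq
  refine ⟨?_, ?_, ?_⟩
  · rintro rfl; simp at hu; linarith
  · rintro rfl; simp at hu; linarith
  · rintro rfl; simp at hu

omit [G.LocallyFinite] in
theorem integrable_rayDensity_densityCoeff (hG : G.IsTree) (hq : 2 ≤ q) (hu : (q : ℝ) < ‖u‖)
    {m : Measure (TreeEnd G o)} [IsProbabilityMeasure m] (hm : ∀ x y, IsChild G o x y →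
      m.real (TreeEnd.arc G o y) = ((q + 1) * (q : ℝ) ^ G.dist o x)⁻¹) :
    Integrable (rayDensity ξ (densityCoeff q u)) m := by
  have hq0 : (0 : ℝ) < q := by positivity
  have hu0 : 0 < ‖u‖ := hq0.trans hu
  refine integrable_rayDensity hG ((summable_nat_add_iff 1).1 ?_)
  have hr : q / ‖u‖ < 1 := (div_lt_one hu0).2 hu
  convert! (summable_geometric_of_lt_one (by positivity) hr).mul_left
    (‖((q : ℂ) + 1) * (u - q) / (q * (u - 1))‖ * (q ^ 2 / ‖u‖) / (q + 1)) using 2 with k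
  rw [hm _ _ (ξ.isChild_vertex hG k), TreeEnd.dist_vertex hG, densityCoeff, norm_mul, norm_pow,
    norm_div ((q : ℂ) ^ 2), norm_pow, Complex.norm_natCast, pow_succ, div_pow, div_pow, ← pow_mul,
    mul_comm 2 k, pow_mul]
  field_simp

omit [G.LocallyFinite] in
/-- Away from the ray of `ξ`, the representing distribution has density `densityCoeff`. -/
theorem distOf_twinRatio_of_ne (hG : G.IsTree) (hq : q ≠ 0) (hu₀ : u ≠ 0) {y : V}
    (hy : ξ.vertex (G.dist o y) ≠ y) {m : Measure (TreeEnd G o)}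
    (hm : ∀ x y, IsChild G o x y →
      m.real (TreeEnd.arc G o y) = ((q + 1) * (q : ℝ) ^ G.dist o x)⁻¹) :
    distOf G o u (twinRatio q u ξ) y =
      m.real (TreeEnd.arc G o y) * densityCoeff q u (ξ.confLevel y) := by
  have hyo : y ≠ o := by rintro rfl; exact hy (by simp [ξ.vertex_zero])
  obtain ⟨x, hx⟩ := exists_parent hG hyo
  have hq' : (q : ℂ) ≠ 0 := by exact_mod_cast hq
  have hq1 : (q : ℂ) + 1 ≠ 0 := by exact_mod_cast Nat.succ_ne_zero q
  have hp := pow_ne_zero (G.dist o x) hu₀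
  rw [distOf_child hG _ _ hx, hm x y hx, twinRatio_child_of_ne ξ hG hx hy, hx.2, pow_succ,
    TreeEnd.confLevel_child hG hx hy, ← mul_sub_one, ← sub_one_mul, twinRatio, densityCoeff]
  push_cast
  rw [div_pow u]
  have : u / q - 1 = (u - q) / q := by field_simp
  rw [this]
  by_cases hu₁ : u = 1
  · subst hu₁; simp
  have := sub_ne_zero.2 hu₁
  field_simp

/-- The distribution which represents the twin ratio is given by a density with respect to the
uniform measure. Off the ray of `ξ` this is a computation; along the ray, the difference of both
sides does not depend on the level, and both sides tend to zero. -/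
theorem setIntegral_rayDensity_eq_distOf (hG : G.IsTree) (hq : 2 ≤ q) (hu : (q : ℝ) < ‖u‖)
    (hdeg : G.IsRegularOfDegree (q + 1))
    {m : Measure (TreeEnd G o)} [IsProbabilityMeasure m] (hm : ∀ x y, IsChild G o x y →
      m.real (TreeEnd.arc G o y) = ((q + 1) * (q : ℝ) ^ G.dist o x)⁻¹) (x : V) :
    ∫ η in TreeEnd.arc G o x, rayDensity ξ (densityCoeff q u) η ∂m =
      distOf G o u (twinRatio q u ξ) x := by
  classical
  obtain ⟨hu₀, hu₁, -⟩ := ne_of_natCast_lt_norm hq hu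
  have hqc : (q : ℂ) ≠ 0 := by exact_mod_cast (by omega : q ≠ 0)
  have hint := integrable_rayDensity_densityCoeff (ξ := ξ) hG hq hu hm
  have hν := isDistribution_distOf hG hdeg hu₀ hu₁
    (isReducedHarmonic_twinRatio ξ hG hdeg hqc hu₀)
  have hoff : ∀ y, ξ.vertex (G.dist o y) ≠ y →
      ∫ η in TreeEnd.arc G o y, rayDensity ξ (densityCoeff q u) η ∂m =
        distOf G o u (twinRatio q u ξ) y := by
    intro y hy
    rw [setIntegral_congr_fun (TreeEnd.measurableSet_arc y)
      fun η hη => rayDensity_of_mem_arc hG hy hη, setIntegral_const,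
      distOf_twinRatio_of_ne hG (by omega) hu₀ hy hm, Complex.real_smul]
  by_cases hx : ξ.vertex (G.dist o x) = x
  swap
  · exact hoff x hx
  let D : ℕ → ℂ := fun n =>
    (∫ η in TreeEnd.arc G o (ξ.vertex n), rayDensity ξ (densityCoeff q u) η ∂m) -
      distOf G o u (twinRatio q u ξ) (ξ.vertex n)
  have hstep : ∀ n, D (n + 1) = D n := by
    intro n
    have hmem : ξ.vertex (n + 1) ∈ children G o (ξ.vertex n) :=
      mem_children.2 (ξ.isChild_vertex hG n)
    simp only [D]
    rw [TreeEnd.setIntegral_arc hG hint (ξ.vertex n), ← hν.sum_children (ξ.vertex n),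
      ← Finset.sum_sub_distrib, Finset.sum_eq_single_of_mem _ hmem]
    intro y hy hne
    rw [mem_children] at hy
    rw [hoff y, sub_self]
    rw [hy.2, TreeEnd.dist_vertex hG]
    exact hne.symm
  have hconst : ∀ n, D n = D 0 := fun n => by
    induction n with
    | zero => rfl
    | succ n ih => rw [hstep, ih]
  have hr : ‖(q : ℂ) / u‖ < 1 := by
    rw [norm_div, Complex.norm_natCast, div_lt_one (norm_pos_iff.2 hu₀)]
    exact hu
  have hlim : Filter.Tendsto (fun n => D (n + 1)) Filter.atTop (nhds 0) := by
    have h1 := (tendsto_setIntegral_rayDensity hG hint).comp (Filter.tendsto_add_atTop_nat 1)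
    have h2 := (tendsto_pow_atTop_nhds_zero_of_norm_lt_one hr).mul_const (((q : ℂ) - 1) / (u - 1))
    have h3 := h1.sub h2
    rw [zero_mul, sub_zero] at h3
    refine h3.congr fun n => ?_
    simp only [D, Function.comp]
    rw [distOf_twinRatio_vertex ξ hG (by omega) hu₀]
  have hD0 : D 0 = 0 := by
    refine tendsto_nhds_unique ?_ hlim
    simp_rw [hconst]
    exact tendsto_const_nhds
  have := hconst (G.dist o x)
  rw [hD0] at this
  simp only [D] at this
  rw [hx] at this
  exact sub_eq_zero.1 this

theorem extendsToMeasure_distOf (hG : G.IsTree) (hq : 2 ≤ q) (hu : (q : ℝ) < ‖u‖)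
    (hdeg : G.IsRegularOfDegree (q + 1)) (ξ : TreeEnd G o) :
    ExtendsToMeasure G o (distOf G o u (twinRatio q u ξ)) := by
  obtain ⟨m, _, hm⟩ := exists_uniform_measure (o := o) hG (by omega : q ≠ 0) hdeg
  refine ⟨m.withDensityᵥ (rayDensity ξ (densityCoeff q u)), fun x => ?_⟩
  rw [withDensityᵥ_apply (integrable_rayDensity_densityCoeff hG hq hu hm)
    (TreeEnd.measurableSet_arc x), setIntegral_rayDensity_eq_distOf hG hq hu hdeg hm]

omit [G.LocallyFinite] in
/-- The representing distribution charges every arc. -/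
theorem distOf_twinRatio_ne_zero (hG : G.IsTree) (hq : 2 ≤ q) (hu : (q : ℝ) < ‖u‖)
    (ξ : TreeEnd G o) (y : V) : distOf G o u (twinRatio q u ξ) y ≠ 0 := by
  obtain ⟨hu₀, hu₁, huq⟩ := ne_of_natCast_lt_norm hq hu
  have hqc : (q : ℂ) ≠ 0 := by exact_mod_cast (by omega : q ≠ 0)
  by_cases hyo : y = o
  · subst hyo
    simp [distOf_root]
  obtain ⟨x, hx⟩ := exists_parent hG hyo
  by_cases hy : ξ.vertex (G.dist o y) = y
  · rw [← hy, hx.2, distOf_twinRatio_vertex ξ hG (by omega) hu₀]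
    have hq1 : (q : ℂ) - 1 ≠ 0 := sub_ne_zero.2 (by exact_mod_cast (by omega : q ≠ 1))
    have := sub_ne_zero.2 hu₁
    positivity
  · rw [distOf_child hG _ _ hx, twinRatio_child_of_ne ξ hG hx hy, ← sub_one_mul]
    refine div_ne_zero (mul_ne_zero (sub_ne_zero.2 ?_) ?_) (pow_dist_sub_ne hu₀ hu₁ hx)
    · rwa [Ne, div_eq_one_iff_eq hqc]
    · rw [twinRatio]
      positivity

theorem exists_probability_measure_distOf (hG : G.IsTree) (hq : 2 ≤ q) {r : ℝ} (hr : (q : ℝ) < r)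
    (hdeg : G.IsRegularOfDegree (q + 1)) (ξ : TreeEnd G o) :
    ∃ μ : Measure (TreeEnd G o), IsProbabilityMeasure μ ∧
      (∀ x, ((μ.real (TreeEnd.arc G o x) : ℝ) : ℂ) = distOf G o (r : ℂ) (twinRatio q (r : ℂ) ξ) x) ∧
      μ.support = Set.univ := by
  have h2 : (2 : ℝ) ≤ q := by exact_mod_cast hq
  have hu : (q : ℝ) < ‖(r : ℂ)‖ := by
    rw [Complex.norm_real, Real.norm_of_nonneg (by linarith)]; exact hr
  obtain ⟨m, _, hm⟩ := exists_uniform_measure (o := o) hG (by omega : q ≠ 0) hdeg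
  have hint := integrable_rayDensity_densityCoeff (ξ := ξ) hG hq hu hm
  set f := rayDensity ξ (densityCoeff q r) with hf
  have hcoeff : ∀ k, ∃ t : ℝ, 0 ≤ t ∧ densityCoeff q (r : ℂ) k = t := fun k => by
    have h1 : 0 < r - q := by linarith
    have h3 : 0 < r - 1 := by linarith
    have h4 : 0 < r := by linarith
    refine ⟨(q + 1) * (r - q) / (q * (r - 1)) * (q ^ 2 / r) ^ k, by positivity, ?_⟩
    rw [densityCoeff]
    push_cast
    rfl
  have hfre : ∀ η, 0 ≤ (f η).re ∧ f η = ((f η).re : ℂ) := fun η => by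
    rcases rayDensity_mem hG ξ η (densityCoeff q r) with h | ⟨k, h⟩
    · simp [hf, h]
    · obtain ⟨t, ht, ht'⟩ := hcoeff k
      rw [hf, h, ht']
      simp [ht]
  have hre : Integrable (fun η => (f η).re) m := hint.re
  let μ := m.withDensity fun η => ENNReal.ofReal (f η).re
  have hμ : ∀ x, ((μ.real (TreeEnd.arc G o x) : ℝ) : ℂ) =
      distOf G o (r : ℂ) (twinRatio q (r : ℂ) ξ) x := fun x => by
    rw [← setIntegral_rayDensity_eq_distOf hG hq hu hdeg hm, ← hf,
      integral_congr_ae (Filter.Eventually.of_forall fun η => (hfre η).2),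
      integral_complex_ofReal, measureReal_def, withDensity_apply _ (TreeEnd.measurableSet_arc x),
      ← ofReal_integral_eq_lintegral_ofReal hre.integrableOn
        (Filter.Eventually.of_forall fun η => (hfre η).1),
      ENNReal.toReal_ofReal (integral_nonneg fun η => (hfre η).1)]
  refine ⟨μ, ⟨?_⟩, hμ, ?_⟩
  · have h1 := hμ o
    rw [distOf_root, twinRatio_root, TreeEnd.arc_root, Complex.ofReal_eq_one, measureReal_def,
      ENNReal.toReal_eq_one_iff] at h1
    exact h1
  · refine Set.eq_univ_of_forall fun η => (Measure.mem_support_iff_forall η).2 fun U hU => ?_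
    obtain ⟨W, hWU, hW, hη⟩ := mem_nhds_iff.1 hU
    obtain ⟨n, hn⟩ := TreeEnd.exists_arc_subset hG hW hη
    refine lt_of_lt_of_le (pos_iff_ne_zero.2 fun h0 => ?_) (measure_mono (hn.trans hWU))
    refine distOf_twinRatio_ne_zero hG hq hu ξ (η.vertex n) ?_
    rw [← hμ, measureReal_def, h0]
    simp

omit [G.LocallyFinite] in
/-- If `|u| < q`, the masses of the arcs shrinking to `ξ` are unbounded. -/
theorem not_extendsToMeasure_distOf (hG : G.IsTree) (hq : 2 ≤ q) (hu₀ : u ≠ 0) (hu₁ : u ≠ 1)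
    (hu : ‖u‖ < q) (ξ : TreeEnd G o) :
    ¬ ExtendsToMeasure G o (distOf G o u (twinRatio q u ξ)) := by
  rintro ⟨μ, hμ⟩
  have h := (VectorMeasure.tendsto_vectorMeasure_iInter_atTop_nat (v := μ)
    (TreeEnd.antitone_arc_vertex hG ξ) fun n => TreeEnd.measurableSet_arc (ξ.vertex n)).norm
  have h1 := h.comp (Filter.tendsto_add_atTop_nat 1)
  have hq0 : q ≠ 0 := by omega
  simp only [Function.comp_def, hμ, distOf_twinRatio_vertex ξ hG hq0 hu₀, norm_mul,
    norm_pow] at h1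
  refine not_tendsto_nhds_of_tendsto_atTop ?_ _ h1
  refine Filter.Tendsto.atTop_mul_const (norm_pos_iff.2 (div_ne_zero ?_ (sub_ne_zero.2 hu₁)))
    (tendsto_pow_atTop_atTop_of_one_lt ?_)
  · exact sub_ne_zero.2 (by exact_mod_cast (by omega : q ≠ 1))
  · rw [norm_div, Complex.norm_natCast, one_lt_div (norm_pos_iff.2 hu₀)]
    exact hu

end Density

/-! ### The two solutions of the quadratic equation -/

section Quadratic

variable {α : ℝ} {lam : ℂ}

theorem Complex.sqrt_sq (z : ℂ) : Complex.sqrt z ^ 2 = z := by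
  rw [Complex.sqrt, ← Complex.cpow_nat_mul]
  norm_num

theorem Complex.re_sqrt_pos {z : ℂ} (h : z ∈ Complex.slitPlane) : 0 < (Complex.sqrt z).re := by
  rw [Complex.sqrt, Complex.cpow_inv_two_re, Real.sqrt_pos]
  rcases h with h | h
  · have := norm_nonneg z
    linarith
  · have := Complex.abs_re_lt_norm.2 h
    have := neg_abs_le z.re
    linarith

theorem rho_sq (hα₀ : 0 < α) (hα₁ : α < 1) : rho α ^ 2 = 4 * (α * (1 - α)) := by
  have : 0 ≤ α * (1 - α) := mul_nonneg hα₀.le (by linarith)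
  rw [rho, mul_pow, Real.sq_sqrt this]
  norm_num

theorem lam_ne_zero (hlam : ∀ t : ℝ, t ∈ Set.Icc (-rho α) (rho α) → lam ≠ (t : ℂ)) : lam ≠ 0 := by
  have h : 0 ≤ rho α := by unfold rho; positivity
  simpa using hlam 0 ⟨by linarith, h⟩

/-- Outside `[-ρ, ρ]` the argument of the square root avoids the branch cut. -/
theorem re_sqrtTerm_pos (hα₀ : 0 < α) (hα₁ : α < 1)
    (hlam : ∀ t : ℝ, t ∈ Set.Icc (-rho α) (rho α) → lam ≠ (t : ℂ)) : 0 < (sqrtTerm α lam).re := by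
  have hl := lam_ne_zero hlam
  refine Complex.re_sqrt_pos ?_
  by_contra hcon
  rw [Complex.mem_slitPlane_iff_not_le_zero, not_not] at hcon
  set z := 1 - 4 * (α : ℂ) * (1 - (α : ℂ)) / lam ^ 2 with hz
  obtain ⟨hre, him⟩ := Complex.nonpos_iff.1 hcon
  have hzre : z = (z.re : ℂ) := by
    apply Complex.ext <;> simp [him]
  have ht : 0 < 1 - z.re := by linarith
  -- `z ≤ 0` makes `λ² = ρ² / (1 - z)` a real number in `(0, ρ²]`
  set v : ℝ := 4 * (α * (1 - α)) / (1 - z.re) with hv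
  have hv0 : 0 ≤ v := by
    have : 0 ≤ 1 - α := by linarith
    positivity
  have hvle : v ≤ rho α ^ 2 := by
    rw [rho_sq hα₀ hα₁, hv]
    refine div_le_self ?_ (by linarith)
    have : 0 ≤ 1 - α := by linarith
    positivity
  have hsq : lam ^ 2 = (√v : ℂ) ^ 2 := by
    rw [← Complex.ofReal_pow, Real.sq_sqrt hv0, hv]
    push_cast
    rw [← hzre, hz, sub_sub_cancel]
    have : (α : ℂ) ≠ 0 := by exact_mod_cast hα₀.ne'
    have : (1 : ℂ) - α ≠ 0 := sub_ne_zero.2 (by exact_mod_cast hα₁.ne')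
    field_simp
  have hrho : 0 ≤ rho α := by unfold rho; positivity
  have hle : √v ≤ rho α := Real.sqrt_le_iff.2 ⟨hrho, hvle⟩
  have hnn := Real.sqrt_nonneg v
  rcases sq_eq_sq_iff_eq_or_eq_neg.1 hsq with h | h
  · exact hlam (√v) ⟨by linarith, hle⟩ h
  · exact hlam (-√v) ⟨by linarith, by linarith⟩ (by rw [h]; simp)

theorem Fminus_add_FminusTwin (hα₀ : 0 < α) : α * (Fminus α lam + FminusTwin α lam) = lam := by
  have : (α : ℂ) ≠ 0 := by exact_mod_cast hα₀.ne'
  rw [Fminus, FminusTwin]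
  field_simp
  ring

theorem Fminus_mul_FminusTwin (hα₀ : 0 < α) (hl : lam ≠ 0) :
    Fminus α lam * FminusTwin α lam = (1 - α) / α := by
  have h0 : (α : ℂ) ≠ 0 := by exact_mod_cast hα₀.ne'
  have h : Fminus α lam * FminusTwin α lam =
      (lam / (2 * α)) ^ 2 * (1 - sqrtTerm α lam ^ 2) := by
    rw [Fminus, FminusTwin]; ring
  rw [h, sqrtTerm, Complex.sqrt_sq]
  field_simp
  ring

theorem norm_Fminus_lt (hα₀ : 0 < α) (hα₁ : α < 1)
    (hlam : ∀ t : ℝ, t ∈ Set.Icc (-rho α) (rho α) → lam ≠ (t : ℂ)) :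
    ‖Fminus α lam‖ < ‖FminusTwin α lam‖ := by
  have hl := lam_ne_zero hlam
  have hs := re_sqrtTerm_pos hα₀ hα₁ hlam
  have h0 : (α : ℂ) ≠ 0 := by exact_mod_cast hα₀.ne'
  rw [Fminus, FminusTwin, norm_mul, norm_mul]
  refine mul_lt_mul_of_pos_left ?_ (norm_pos_iff.2 (div_ne_zero hl (mul_ne_zero two_ne_zero h0)))
  refine lt_of_pow_lt_pow_left₀ 2 (norm_nonneg _) ?_
  rw [Complex.sq_norm, Complex.sq_norm, Complex.normSq_apply, Complex.normSq_apply]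
  simp
  nlinarith

/-- The values `±λ₀` are those with `F̃₋ = q F₋`, for which the kernels degenerate. -/
theorem lam_eq_lambda0_of_eq {q : ℕ} (hq : q ≠ 0) (hα₀ : 0 < α) (hα₁ : α < 1) (hl : lam ≠ 0)
    (h : q * Fminus α lam = FminusTwin α lam) :
    lam = (lambda0 q α : ℂ) ∨ lam = -(lambda0 q α : ℂ) := by
  rw [← sq_eq_sq_iff_eq_or_eq_neg]
  have h0 : (α : ℂ) ≠ 0 := by exact_mod_cast hα₀.ne'
  have hq' : (q : ℂ) ≠ 0 := by exact_mod_cast hq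
  have hsum := Fminus_add_FminusTwin (lam := lam) hα₀
  have hmul := Fminus_mul_FminusTwin hα₀ hl
  rw [← h] at hsum hmul
  have hF : Fminus α lam ^ 2 = (1 - α) / (α * q) := by
    rw [eq_div_iff (by positivity), pow_two]
    rw [eq_div_iff h0] at hmul
    linear_combination hmul
  have hr : lambda0 q α ^ 2 = ((q : ℝ) + 1) ^ 2 / q * (α * (1 - α)) := by
    rw [lambda0, mul_pow, rho_sq hα₀ hα₁, div_pow, mul_pow, Real.sq_sqrt (Nat.cast_nonneg q)]
    ring
  rw [← Complex.ofReal_pow, hr, ← hsum, ← one_add_mul, mul_pow, mul_pow, hF]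
  push_cast
  field_simp
  ring

end Quadratic

/-! ### The two kernels in reduced form -/

section Kernels

variable {V : Type*} {G : SimpleGraph V} {o : V}

theorem affineWeight_isChild {R : Type*} [Zero R] (hG : G.IsTree) (ϖ : TreeEnd G o) (a b : R)
    {x y : V} (h : IsChild G o x y) : affineWeight ϖ a b x y = a ∧ affineWeight ϖ a b y x = b ∨
      affineWeight ϖ a b x y = b ∧ affineWeight ϖ a b y x = a := by
  rcases TreeEnd.hor_child hG ϖ h with h | h
  · left
    constructor
    · rw [affineWeight, if_pos h]
    · rw [affineWeight, if_neg (by omega), if_pos (by omega)]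
  · right
    constructor
    · rw [affineWeight, if_neg (by omega), if_pos h]
    · rw [affineWeight, if_pos (by omega)]

variable {α : ℝ} {q : ℕ} {a b : ℂ}

theorem treePoissonKernel_affine (hG : G.IsTree) (ϖ : TreeEnd G o) (hq : (q : ℂ) ≠ 0)
    (ha : a ≠ 0) (hb : b ≠ 0) (hα : (α : ℂ) ≠ 0)
    (hab : a * b = (1 - α) / α) (x : V) (η : TreeEnd G o) :
    treePoissonKernel hG (affineWeight ϖ (α / ((1 - α) * q) * a) a) x η =
      pathWeight hG (affineWeight ϖ (α / ((1 - α) * q) * a) a) x o *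
        (q * b / a) ^ η.confLevel x := by
  have hw : (α / ((1 - α) * q) * a * a : ℂ) = (q * b / a)⁻¹ := by
    rw [eq_div_iff hα] at hab
    rw [← hab]
    field_simp
  rw [treePoissonKernel_eq hG _ (w := (q * b / a)⁻¹) (by positivity) _ x η, inv_inv]
  intro x y h
  rcases affineWeight_isChild hG ϖ (α / ((1 - α) * q) * a) a h with ⟨h1, h2⟩ | ⟨h1, h2⟩
  · rw [h1, h2, hw]
  · rw [h1, h2, mul_comm, hw]

theorem pathWeight_child (hG : G.IsTree) (f : V → V → ℂ) {x y : V} (h : IsChild G o x y) :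
    pathWeight hG f y o = f y x * pathWeight hG f x o :=
  pathWeight_cons hG f h.1.symm (by rw [G.dist_comm, h.2, G.dist_comm])

theorem pathWeight_affine_ne_zero (hG : G.IsTree) (ϖ : TreeEnd G o) (ha : a ≠ 0) (hb : b ≠ 0)
    (x : V) : pathWeight hG (affineWeight ϖ a b) x o ≠ 0 := by
  induction x using tree_induction (o := o) hG with
  | root => rw [pathWeight_self]; exact one_ne_zero
  | child x y h ih =>
    rw [pathWeight_child hG _ h]
    rcases affineWeight_isChild hG ϖ a b h with ⟨-, h2⟩ | ⟨-, h2⟩ <;> rw [h2] <;> positivity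

/-- Rescaling all edge weights by `t`. -/
theorem pathWeight_affine_smul (hG : G.IsTree) (ϖ : TreeEnd G o) (c t : ℂ) (x : V) :
    pathWeight hG (affineWeight ϖ (c * (t * a)) (t * a)) x o =
      t ^ G.dist o x * pathWeight hG (affineWeight ϖ (c * a) a) x o := by
  induction x using tree_induction (o := o) hG with
  | root => simp [pathWeight_self]
  | child x y h ih =>
    rw [pathWeight_child hG _ h, pathWeight_child hG _ h, ih, h.2]
    have : affineWeight ϖ (c * (t * a)) (t * a) y x = t * affineWeight ϖ (c * a) a y x := by
      unfold affineWeight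
      split_ifs <;> ring
    rw [this]
    ring

theorem treePoissonKernel_affine_twin (hG : G.IsTree) (ϖ : TreeEnd G o) (hq : (q : ℂ) ≠ 0)
    (ha : a ≠ 0) (hb : b ≠ 0) (hα : (α : ℂ) ≠ 0)
    (hab : a * b = (1 - α) / α) (x : V) (ξ : TreeEnd G o) :
    treePoissonKernel hG (affineWeight ϖ (α / ((1 - α) * q) * b) b) x ξ =
      pathWeight hG (affineWeight ϖ (α / ((1 - α) * q) * a) a) x o *
        twinRatio q (q * b / a) ξ x := by
  rw [treePoissonKernel_affine hG ϖ hq hb ha hα (by rw [mul_comm, hab]) x ξ]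
  have hba : b = b / a * a := by field_simp
  have h1 := pathWeight_affine_smul (a := a) hG ϖ (α / ((1 - α) * q)) (b / a) x
  rw [← hba] at h1
  have e1 : q * b / a / q = b / a := by field_simp
  have e2 : (q : ℂ) ^ 2 / (q * b / a) = q * a / b := by field_simp
  rw [h1, twinRatio, e1, e2]
  ring

end Kernels

/-! ### Positive harmonic functions -/

section Harmonic

variable {V : Type*} {G : SimpleGraph V} {o : V} [G.LocallyFinite] {q : ℕ}

theorem IsReducedHarmonic.add_mul {𝕜 : Type*} [Field 𝕜] {u : 𝕜} {H H' : V → 𝕜}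
    (h : IsReducedHarmonic G o q u H) (h' : IsReducedHarmonic G o q u H') (c : 𝕜) :
    IsReducedHarmonic G o q u (fun x => H x + c * H' x) := by
  constructor
  · rw [Finset.sum_add_distrib, ← Finset.mul_sum, h.1, h'.1]
    ring
  · intro x y hxy
    rw [Finset.sum_add_distrib, ← Finset.mul_sum]
    linear_combination h.2 x y hxy + c * h'.2 x y hxy

variable {α l a : ℝ} {ϖ : TreeEnd G o} {g H : V → ℝ}

/-- Multiplication by `g(x) = F(x, o)` turns solutions of the reduced equation into `λ`-harmonic
functions. -/
theorem transOp_mul (hG : G.IsTree) (hq : (q : ℝ) ≠ 0) (hα : α ≠ 0) (hα' : 1 - α ≠ 0)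
    (ha : a ≠ 0) (hl : α * a + (1 - α) / a = l)
    (hg : ∀ x y, IsChild G o x y → g y = affineWeight ϖ (α / ((1 - α) * q) * a) a y x * g x)
    (hH : IsReducedHarmonic G o q ((1 - α) * q / (α * a ^ 2)) H) (y : V) :
    transOp ϖ q α (fun x => g x * H x) y = l * (g y * H y) := by
  have hdown : ∀ z ∈ children G o y, affineWeight ϖ (α / (q : ℝ)) (1 - α) y z * (g z * H z) =
      α * a / q * g y * H z := by
    intro z hz
    rw [mem_children] at hz
    rw [hg y z hz]
    rcases TreeEnd.hor_child hG ϖ hz with h | h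
    · rw [affineWeight, if_pos h, affineWeight, if_neg (by omega), if_pos (by omega)]
      field_simp
    · rw [affineWeight, if_neg (by omega), if_pos h, affineWeight, if_pos (by omega)]
      field_simp
  rw [transOp]
  by_cases hy : y = o
  · subst hy
    rw [neighborFinset_root hG, Finset.sum_congr rfl hdown, ← Finset.mul_sum, hH.1, ← hl]
    field_simp
  · obtain ⟨x, hx⟩ := exists_parent hG hy
    have hup : affineWeight ϖ (α / (q : ℝ)) (1 - α) y x * (g x * H x) =
        (1 - α) / a * g y * H x := by
      rw [hg x y hx]
      unfold affineWeight
      have := TreeEnd.hor_child hG ϖ hx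
      split_ifs with h1 h2
      · field_simp
      · field_simp
      · omega
    rw [sum_neighborFinset hG hx, hup, Finset.sum_congr rfl hdown, ← Finset.mul_sum,
      eq_sub_of_add_eq (hH.2 x y hx), ← hl]
    field_simp
    ring

open Classical in
/-- A solution of the reduced equation which lives, with opposite signs, on the branches of two
neighbours `y₁`, `y₂` of the root. -/
noncomputable def branchDifference (G : SimpleGraph V) (o y₁ y₂ : V) (t : ℝ) (x : V) : ℝ :=
  (t ^ G.dist o x - 1) *
    ((if G.dist o y₁ + G.dist y₁ x = G.dist o x then 1 else 0) -
      (if G.dist o y₂ + G.dist y₂ x = G.dist o x then 1 else 0))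

variable {y₁ y₂ : V}

omit [G.LocallyFinite] in
theorem not_dist_add_dist_root (h₁ : IsChild G o o y₁) :
    ¬ G.dist o y₁ + G.dist y₁ o = G.dist o o := by
  have := h₁.2
  simp [this]

omit [G.LocallyFinite] in
theorem dist_add_dist_child_root (hG : G.IsTree) (h₁ : IsChild G o o y₁) {y : V}
    (hy : IsChild G o o y) : G.dist o y₁ + G.dist y₁ y = G.dist o y ↔ y = y₁ := by
  constructor
  · intro h
    by_contra hne
    exact not_dist_add_dist_root h₁ ((hy.dist_add_dist_iff hG (Ne.symm hne)).1 h)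
  · rintro rfl
    simp

omit [G.LocallyFinite] in
theorem dist_add_dist_child (hG : G.IsTree) (h₁ : IsChild G o o y₁) {x y z : V}
    (hxy : IsChild G o x y) (hyz : IsChild G o y z) :
    G.dist o y₁ + G.dist y₁ z = G.dist o z ↔ G.dist o y₁ + G.dist y₁ y = G.dist o y := by
  refine hyz.dist_add_dist_iff hG ?_
  rintro rfl
  have e1 := h₁.2
  have e2 := hxy.2
  have e3 := hyz.2
  rw [SimpleGraph.dist_self] at e1
  omega

theorem isReducedHarmonic_branchDifference (hG : G.IsTree) (hdeg : G.IsRegularOfDegree (q + 1))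
    (hq : (q : ℝ) ≠ 0) (h₁ : IsChild G o o y₁) (h₂ : IsChild G o o y₂) (r : ℝ) :
    IsReducedHarmonic G o q r (branchDifference G o y₁ y₂ (r / q)) := by
  classical
  constructor
  · rw [Finset.sum_congr rfl (g := fun y => (r / q - 1) *
      ((if y = y₁ then 1 else 0) - (if y = y₂ then 1 else 0)))]
    · rw [← Finset.mul_sum, Finset.sum_sub_distrib, Finset.sum_ite_eq', Finset.sum_ite_eq',
        if_pos (mem_children.2 h₁), if_pos (mem_children.2 h₂)]
      simp [branchDifference]
    · intro y hy
      rw [mem_children] at hy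
      simp only [branchDifference, dist_add_dist_child_root hG h₁ hy, dist_add_dist_child_root hG h₂ hy]
      rw [hy.2]
      simp
  · intro x y hxy
    obtain ⟨s, hs⟩ : ∃ s : ℝ, s = (if G.dist o y₁ + G.dist y₁ y = G.dist o y then 1 else 0) -
      (if G.dist o y₂ + G.dist y₂ y = G.dist o y then 1 else 0) := ⟨_, rfl⟩
    have hz : ∀ z ∈ children G o y, branchDifference G o y₁ y₂ (r / q) z =
        ((r / q) ^ (G.dist o x + 2) - 1) * s := by
      intro z hz
      rw [mem_children] at hz
      simp only [branchDifference, dist_add_dist_child hG h₁ hxy hz, dist_add_dist_child hG h₂ hxy hz]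
      rw [hz.2, hxy.2, ← hxy.2, ← hs, hxy.2]
    have hx : branchDifference G o y₁ y₂ (r / q) x = ((r / q) ^ G.dist o x - 1) * s := by
      by_cases hxo : x = o
      · subst hxo
        simp [branchDifference]
      · obtain ⟨w, hw⟩ := exists_parent hG hxo
        simp only [hs, dist_add_dist_child hG h₁ hw hxy, dist_add_dist_child hG h₂ hw hxy]
        rw [branchDifference]
    have hy : branchDifference G o y₁ y₂ (r / q) y = ((r / q) ^ (G.dist o x + 1) - 1) * s := by
      rw [branchDifference, ← hs, hxy.2]
    rw [Finset.sum_congr rfl hz, hx, hy, Finset.sum_const, card_children hG hdeg hxy, nsmul_eq_mul]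
    rw [pow_succ, pow_succ]
    field_simp
    ring

omit [G.LocallyFinite] in
/-- On the branch of a neighbour of the root off the ray of `ξ`, the confluent with `ξ` is the
root. -/
theorem confLevel_eq_zero_of_branch (hG : G.IsTree) {ξ : TreeEnd G o} (h₁ : IsChild G o o y₁)
    (hξ : y₁ ≠ ξ.vertex 1) {x : V} (hx : G.dist o y₁ + G.dist y₁ x = G.dist o x) :
    ξ.confLevel x = 0 := by
  induction x using tree_induction (o := o) hG with
  | root => simp
  | child x y hxy ih =>
    by_cases hxo : x = o
    · subst hxo
      obtain rfl := (dist_add_dist_child_root hG h₁ hxy).1 hx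
      rw [TreeEnd.confLevel_child hG hxy, TreeEnd.confLevel_root]
      rw [hxy.2, SimpleGraph.dist_self]
      exact hξ.symm
    · obtain ⟨w, hw⟩ := exists_parent hG hxo
      have h0 := ih ((dist_add_dist_child hG h₁ hw hxy).1 hx)
      rw [TreeEnd.confLevel_child hG hxy, h0]
      intro hy
      rw [TreeEnd.confLevel_of_vertex_eq (TreeEnd.vertex_of_isChild hG hxy hy)] at h0
      have := hw.2
      omega

omit [G.LocallyFinite] in
theorem abs_branchDifference_lt (hG : G.IsTree) (hq : 0 < q) {r : ℝ} (hr : (q : ℝ) < r)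
    {ξ : TreeEnd G o} (h₁ : IsChild G o o y₁) (h₂ : IsChild G o o y₂)
    (hξ₁ : y₁ ≠ ξ.vertex 1) (hξ₂ : y₂ ≠ ξ.vertex 1) (x : V) :
    |branchDifference G o y₁ y₂ (r / q) x| < twinRatio q r ξ x := by
  have hq' : (0 : ℝ) < q := by exact_mod_cast hq
  have hr' : 0 < r := hq'.trans hr
  have ht : 1 ≤ (r / q) ^ G.dist o x := one_le_pow₀ ((one_le_div hq').2 hr.le)
  rw [branchDifference, twinRatio]
  split_ifs with c1 c2 c2
  · rw [sub_self, mul_zero, abs_zero]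
    positivity
  · rw [confLevel_eq_zero_of_branch hG h₁ hξ₁ c1, sub_zero, mul_one, pow_zero, mul_one,
      abs_of_nonneg (by linarith)]
    linarith
  · rw [confLevel_eq_zero_of_branch hG h₂ hξ₂ c2, zero_sub, mul_neg, mul_one, pow_zero, mul_one,
      abs_neg, abs_of_nonneg (by linarith)]
    linarith
  · rw [sub_self, mul_zero, abs_zero]
    positivity

/-- The function `g · twinRatio` is harmonic, and it is the midpoint of its two perturbations by
`± g · branchDifference`. -/
theorem mul_twinRatio_not_extreme (hG : G.IsTree) (hq : 2 ≤ q) (hdeg : G.IsRegularOfDegree (q + 1))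
    (hα : α ≠ 0) (hα' : 1 - α ≠ 0) (ha : a ≠ 0) (hl : α * a + (1 - α) / a = l)
    (hg : ∀ x y, IsChild G o x y → g y = affineWeight ϖ (α / ((1 - α) * q) * a) a y x * g x)
    (hg₀ : ∀ x, 0 < g x) (hgo : g o = 1) {r : ℝ} (hr : r = (1 - α) * q / (α * a ^ 2))
    (hrq : (q : ℝ) < r) (ξ : TreeEnd G o) :
    (fun x => g x * twinRatio q r ξ x) ∈ positiveHarmonic ϖ q α l ∧
      (fun x => g x * twinRatio q r ξ x) ∉ (positiveHarmonic ϖ q α l).extremePoints ℝ := by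
  classical
  have hq0 : (0 : ℝ) < q := by positivity
  have hr0 : r ≠ 0 := (hq0.trans hrq).ne'
  have hcard := card_children_root (o := o) hG hdeg
  have hmem : ξ.vertex 1 ∈ children G o o := by
    have := ξ.isChild_vertex hG 0
    rw [ξ.vertex_zero] at this
    exact mem_children.2 this
  have hcard' : 1 < ((children G o o).erase (ξ.vertex 1)).card := by
    rw [Finset.card_erase_of_mem hmem, hcard]; omega
  obtain ⟨y₁, hy₁, y₂, hy₂, hne⟩ := Finset.one_lt_card.1 hcard'
  rw [Finset.mem_erase, mem_children] at hy₁ hy₂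
  have hH := isReducedHarmonic_twinRatio ξ hG hdeg hq0.ne' hr0
  have hA := isReducedHarmonic_branchDifference hG hdeg hq0.ne' hy₁.2 hy₂.2 r
  have hlt := abs_branchDifference_lt hG (by omega) hrq hy₁.2 hy₂.2 hy₁.1 hy₂.1
  have hpos : ∀ c : ℝ, |c| ≤ 1 →
      (fun x => g x * (twinRatio q r ξ x + c * branchDifference G o y₁ y₂ (r / q) x)) ∈
        positiveHarmonic ϖ q α l := by
    intro c hc
    refine ⟨fun x => mul_pos (hg₀ x) ?_, ?_, fun x => ?_⟩
    · have h1 : |c * branchDifference G o y₁ y₂ (r / q) x| ≤ |branchDifference G o y₁ y₂ (r / q) x| := by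
        rw [abs_mul]
        exact mul_le_of_le_one_left (abs_nonneg _) hc
      have h2 := neg_abs_le (c * branchDifference G o y₁ y₂ (r / q) x)
      have h3 := hlt x
      linarith
    · simp [hgo, branchDifference]
    · refine transOp_mul hG hq0.ne' hα hα' ha hl hg ?_ x
      rw [← hr]
      exact hH.add_mul hA c
  constructor
  · simpa using hpos 0 (by simp)
  · intro hext
    have h1 := (mem_extremePoints.1 hext).2 _ (hpos 1 (by simp)) _ (hpos (-1) (by simp))
      ⟨1 / 2, 1 / 2, by norm_num, by norm_num, by norm_num, by
        funext x
        simp only [Pi.add_apply, Pi.smul_apply, smul_eq_mul]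
        ring⟩
    have h2 := congrFun h1.1 y₁
    have h3 : branchDifference G o y₁ y₂ (r / q) y₁ = r / q - 1 := by
      rw [branchDifference, if_pos (by simp),
        if_neg (by rw [dist_add_dist_child_root hG hy₂.2 hy₁.2]; exact hne), hy₁.2.2]
      simp
    have h4 := mul_left_cancel₀ (hg₀ y₁).ne' h2
    have h5 : 1 < r / q := (one_lt_div hq0).2 hrq
    linarith

end Harmonic

/-! ### Real eigenvalues above the spectral radius -/

section RealEigenvalue

variable {α l : ℝ}

/-- For real `λ > ρ` both solutions of the quadratic equation are positive reals. -/
theorem exists_real_Fminus (hα₀ : 0 < α) (hα₁ : α < 1) (hl : rho α < l) :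
    ∃ a b : ℝ, 0 < a ∧ a < b ∧ Fminus α (l : ℂ) = a ∧ FminusTwin α (l : ℂ) = b := by
  have hrho : 0 ≤ rho α := by unfold rho; positivity
  have hl0 : 0 < l := hrho.trans_lt hl
  have hβ : 0 < 1 - α := by linarith
  have hz1 : 4 * α * (1 - α) / l ^ 2 < 1 := by
    rw [div_lt_one (by positivity), mul_assoc, ← rho_sq hα₀ hα₁]
    exact pow_lt_pow_left₀ hl hrho two_ne_zero
  have hz0 : 0 < 4 * α * (1 - α) / l ^ 2 := by positivity
  set z : ℝ := 1 - 4 * α * (1 - α) / l ^ 2 with hz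
  have hs : sqrtTerm α (l : ℂ) = (√z : ℝ) := by
    have : (1 - 4 * (α : ℂ) * (1 - (α : ℂ)) / (l : ℂ) ^ 2) = (z : ℂ) := by
      rw [hz]; push_cast; rfl
    rw [sqrtTerm, this, Complex.sqrt_of_nonneg (by exact_mod_cast (by linarith : 0 ≤ z)),
      Complex.ofReal_re]
  have hs0 : 0 < √z := Real.sqrt_pos.2 (by linarith)
  have hs1 : √z < 1 := (Real.sqrt_lt' one_pos).2 (by linarith)
  have hc : 0 < l / (2 * α) := by positivity
  refine ⟨l / (2 * α) * (1 - √z), l / (2 * α) * (1 + √z), mul_pos hc (by linarith),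
    mul_lt_mul_of_pos_left (by linarith) hc, ?_, ?_⟩
  · rw [Fminus, hs]; push_cast; rfl
  · rw [FminusTwin, hs]; push_cast; rfl

variable {V : Type*} {G : SimpleGraph V} {o : V}

/-- Path weights to the root for positive real edge weights. -/
theorem exists_real_pathWeight (hG : G.IsTree) (ϖ : TreeEnd G o) {a b : ℝ} (ha : 0 < a)
    (hb : 0 < b) : ∃ g : V → ℝ, (∀ x, 0 < g x) ∧ g o = 1 ∧
      (∀ x y, IsChild G o x y → g y = affineWeight ϖ a b y x * g x) ∧
      ∀ x, pathWeight hG (affineWeight ϖ (a : ℂ) (b : ℂ)) x o = g x := by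
  have hw : ∀ x y, affineWeight ϖ (a : ℂ) (b : ℂ) x y = (affineWeight ϖ a b x y : ℝ) := by
    intro x y
    unfold affineWeight
    split_ifs <;> simp
  have key : ∀ x, 0 < (pathWeight hG (affineWeight ϖ (a : ℂ) (b : ℂ)) x o).re ∧
      pathWeight hG (affineWeight ϖ (a : ℂ) (b : ℂ)) x o =
        ((pathWeight hG (affineWeight ϖ (a : ℂ) (b : ℂ)) x o).re : ℂ) := by
    intro x
    induction x using tree_induction (o := o) hG with
    | root => simp [pathWeight_self]
    | child x y h ih =>
      rw [pathWeight_child hG _ h, ih.2, hw, ← Complex.ofReal_mul, Complex.ofReal_re]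
      refine ⟨mul_pos ?_ ih.1, rfl⟩
      rcases affineWeight_isChild hG ϖ a b h with ⟨-, h2⟩ | ⟨-, h2⟩ <;> rw [h2] <;> assumption
  refine ⟨fun x => (pathWeight hG (affineWeight ϖ (a : ℂ) (b : ℂ)) x o).re, fun x => (key x).1,
    by simp [pathWeight_self], fun x y h => ?_, fun x => (key x).2⟩
  simp only
  rw [pathWeight_child hG _ h, hw, Complex.re_ofReal_mul]

end RealEigenvalue

/-! ### Kernel representations and non-minimality -/

theorem theorem4p5 {V : Type*} (G : SimpleGraph V) [G.LocallyFinite] (hG : G.IsTree)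
    (q : ℕ) (hq : 2 ≤ q) (hdeg : G.IsRegularOfDegree (q + 1))
    (o : V) (ϖ : TreeEnd G o) (α : ℝ) (hα₀ : 0 < α) (hα₁ : α < 1)
    (lam : ℂ) (hlam : ∀ t : ℝ, t ∈ Set.Icc (-rho α) (rho α) → lam ≠ (t : ℂ))
    (hlam₀ : lam ≠ (lambda0 q α : ℂ)) (ξ : TreeEnd G o) :
    -- the distribution representing the twin kernel through the Martin kernel
    (∃ ν : V → ℂ,
      Represents G o (martinKernel hG ϖ q α lam) ν (fun x => twinKernel hG ϖ q α lam x ξ) ∧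
      (∀ ν' : V → ℂ,
        Represents G o (martinKernel hG ϖ q α lam) ν' (fun x => twinKernel hG ϖ q α lam x ξ) →
          ν' = ν) ∧
      ExtendsToMeasure G o ν ∧
      (∀ l : ℝ, lam = (l : ℂ) → rho α < l →
        ∃ μ : MeasureTheory.Measure (TreeEnd G o), MeasureTheory.IsProbabilityMeasure μ ∧
          (∀ x, ((μ.real (TreeEnd.arc G o x) : ℝ) : ℂ) = ν x) ∧ μ.support = Set.univ)) ∧
    -- the distribution representing the Martin kernel through the twin kernel
    (lam ≠ -(lambda0 q α : ℂ) →
      ∃ ν : V → ℂ,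
        Represents G o (twinKernel hG ϖ q α lam) ν (fun x => martinKernel hG ϖ q α lam x ξ) ∧
        (∀ ν' : V → ℂ,
          Represents G o (twinKernel hG ϖ q α lam) ν' (fun x => martinKernel hG ϖ q α lam x ξ) →
            ν' = ν) ∧
        ¬ ExtendsToMeasure G o ν) ∧
    -- the twin kernel is a positive harmonic function which is not minimal
    (∀ l : ℝ, lam = (l : ℂ) → rho α < l →
      ∃ h ∈ positiveHarmonic ϖ q α l, (∀ x, (h x : ℂ) = twinKernel hG ϖ q α lam x ξ) ∧
        h ∉ (positiveHarmonic ϖ q α l).extremePoints ℝ) := by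
  have hl := lam_ne_zero hlam
  have hα : (α : ℂ) ≠ 0 := by exact_mod_cast hα₀.ne'
  have hβ : (1 - α : ℂ) ≠ 0 := sub_ne_zero.2 (by exact_mod_cast hα₁.ne')
  have hq0 : q ≠ 0 := by omega
  have hqc : (q : ℂ) ≠ 0 := by exact_mod_cast hq0
  have hqr : (0 : ℝ) < q := by exact_mod_cast Nat.pos_of_ne_zero hq0
  have hmul := Fminus_mul_FminusTwin (lam := lam) hα₀ hl
  have hlt := norm_Fminus_lt hα₀ hα₁ hlam
  have hlam_deg : q * Fminus α lam = FminusTwin α lam →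
      lam = (lambda0 q α : ℂ) ∨ lam = -(lambda0 q α : ℂ) :=
    lam_eq_lambda0_of_eq hq0 hα₀ hα₁ hl
  have ha : Fminus α lam ≠ 0 := left_ne_zero_of_mul (by rw [hmul]; positivity)
  have hb : FminusTwin α lam ≠ 0 := right_ne_zero_of_mul (by rw [hmul]; positivity)
  obtain ⟨e, he⟩ := exists_section (o := o) hG hq0 hdeg
  have hc : (α / ((1 - α) * q) : ℂ) ≠ 0 := by positivity
  set a := Fminus α lam with ha_def
  set b := FminusTwin α lam with hb_def
  have hmul' : b * a = (1 - α) / α := by rw [mul_comm, hmul]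
  have hab : q * b / a ≠ 0 := by positivity
  have hba : q * a / b ≠ 0 := by positivity
  have hnorm : (q : ℝ) < ‖q * b / a‖ := by
    rw [norm_div, norm_mul, Complex.norm_natCast, lt_div_iff₀ (norm_pos_iff.2 ha)]
    exact mul_lt_mul_of_pos_left hlt hqr
  have hnorm' : ‖q * a / b‖ < q := by
    rw [norm_div, norm_mul, Complex.norm_natCast, div_lt_iff₀ (norm_pos_iff.2 hb)]
    exact mul_lt_mul_of_pos_left hlt hqr
  refine ⟨?_, fun hlam₁ => ?_, ?_⟩
  · have hrep := represents_iff_eq_distOf hG hdeg he hab (ne_of_natCast_lt_norm hq hnorm).2.1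
      (isReducedHarmonic_twinRatio ξ hG hdeg hqc hab)
      (pathWeight_affine_ne_zero hG ϖ (mul_ne_zero hc ha) ha)
      (k := martinKernel hG ϖ q α lam)
      (fun x η => treePoissonKernel_affine hG ϖ hqc ha hb hα hmul x η)
      (h := fun x => twinKernel hG ϖ q α lam x ξ)
      (fun x => treePoissonKernel_affine_twin hG ϖ hqc ha hb hα hmul x ξ)
    refine ⟨_, (hrep _).2 rfl, fun ν' => (hrep ν').1, extendsToMeasure_distOf hG hq hnorm hdeg ξ,
      fun l hll hrl => ?_⟩
    obtain ⟨s, t, hs, hst, hFs, hFt⟩ := exists_real_Fminus hα₀ hα₁ hrl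
    have hu : q * b / a = ((q * t / s : ℝ) : ℂ) := by
      rw [ha_def, hb_def, hll, hFs, hFt]; push_cast; rfl
    rw [hu]
    refine exists_probability_measure_distOf hG hq ?_ hdeg ξ
    rw [lt_div_iff₀ hs]
    exact mul_lt_mul_of_pos_left hst hqr
  · have hne : q * a / b ≠ 1 := fun h => by
      rw [div_eq_one_iff_eq hb] at h
      rcases hlam_deg h with h | h
      exacts [hlam₀ h, hlam₁ h]
    have hrep := represents_iff_eq_distOf hG hdeg he hba hne
      (isReducedHarmonic_twinRatio ξ hG hdeg hqc hba)
      (pathWeight_affine_ne_zero hG ϖ (mul_ne_zero hc hb) hb)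
      (k := twinKernel hG ϖ q α lam)
      (fun x η => treePoissonKernel_affine hG ϖ hqc hb ha hα hmul' x η)
      (h := fun x => martinKernel hG ϖ q α lam x ξ)
      (fun x => treePoissonKernel_affine_twin hG ϖ hqc hb ha hα hmul' x ξ)
    exact ⟨_, (hrep _).2 rfl, fun ν' => (hrep ν').1,
      not_extendsToMeasure_distOf hG hq hba hne hnorm' ξ⟩
  · intro l hll hrl
    obtain ⟨s, t, hs, hst, hFs, hFt⟩ := exists_real_Fminus hα₀ hα₁ hrl
    have hβr : 0 < 1 - α := by linarith
    have has : a = s := by rw [ha_def, hll, hFs]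
    have hbt : b = t := by rw [hb_def, hll, hFt]
    have hstmul : s * t = (1 - α) / α := by
      rw [has, hbt] at hmul
      exact_mod_cast hmul
    have hsum : α * (s + t) = l := by
      have := Fminus_add_FminusTwin (lam := lam) hα₀
      rw [← ha_def, ← hb_def, has, hbt, hll] at this
      exact_mod_cast this
    have ht : t = (1 - α) / (α * s) := by
      rw [eq_div_iff hα₀.ne'] at hstmul
      rw [eq_div_iff (by positivity)]
      linear_combination hstmul
    obtain ⟨g, hg₀, hgo, hg, hgw⟩ := exists_real_pathWeight hG ϖ
      (a := α / ((1 - α) * q) * s) (b := s) (by positivity) hs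
    have hmain := mul_twinRatio_not_extreme (ϖ := ϖ) (l := l) (r := q * t / s) hG hq hdeg hα₀.ne'
      hβr.ne' hs.ne' (by rw [← hsum, ht]; field_simp) hg hg₀ hgo (by rw [ht]; field_simp)
      (by rw [lt_div_iff₀ hs]; exact mul_lt_mul_of_pos_left hst hqr) ξ
    refine ⟨_, hmain.1, fun x => ?_, hmain.2⟩
    have hK : twinKernel hG ϖ q α lam x ξ =
        pathWeight hG (affineWeight ϖ (α / ((1 - α) * q) * a) a) x o *
          twinRatio q (q * b / a) ξ x :=
      treePoissonKernel_affine_twin hG ϖ hqc ha hb hα hmul x ξ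
    have hgx := hgw x
    push_cast at hgx
    rw [hK, has, hbt, hgx, twinRatio, twinRatio]
    push_cast
    rfl
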